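/- Let $A\in\mathbb R^{d\times d}$, $B\in\mathbb R^{d\times m}$, let $\Pi^s\in\mathbb R^{d_s\times d}$ be an orthogonal projection onto the slow variables (i.e. $\Pi^s(\Pi^s)^{T}=I$), and let $P_0$ be a Gaussian law on $\mathbb R^d$. Let $X$ be a solution of the linear SDE $dX_t=AX_t\,dt+B\,dW_t$ with a standard $m$-dimensional Wiener process $W$ and $X_0\sim P_0$ independent of $W$, and let $P_T$ denote the law of $X_T$, for a fixed $T>0$. For step sizes $0<\delta t\le\Delta t$, a micro-macro acceleration run (one inner step, slow-mean extrapolation, Kullback–Leibler matching) is a sequence of laws $P_0,P_1,P_2,\dots$ started at $P_0$ such that for every $n\ge 0$: (1) $P_{n,1}$ is the law of $(I+\delta t A)Y+\sqrt{\delta t}\,B\xi$, where $Y\sim P_n$ and $\xi\sim\mathcal N(0,I_m)$ are independent; (2) $\mu^s_{n}=\mathbb E_{P_n}[\Pi^s]$ and $\mu^s_{n,1}=\mathbb E_{P_{n,1}}[\Pi^s]$; (3) $\mu^s_{n+1}=\mu^s_n+\frac{\Delta t}{\delta t}(\mu^s_{n,1}-\mu^s_n)$; (4) $P_{n+1}$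 minimizes $\mathcal D(Q\,\|\,P_{n,1})=\mathbb E_Q[\ln\frac{dQ}{dP_{n,1}}]$ (equal to $+\infty$ if $Q\not\ll P_{n,1}$) over all probability laws $Q$ with $\mathbb E_Q[\Pi^s]=\mu^s_{n+1}$, the minimum being finite. (i) If the covariance matrix of $P_0$ or the matrix $BB^T$ is positive definite, then for all sufficiently small $\delta t>0$ and all $\Delta t\ge\delta t$ there is exactly one such run. (ii) Assume that $P_T$ has a positive definite covariance matrix, and that for all sufficiently small $\delta t>0$ and all $\Delta t>\delta t$ sufficiently close to $\delta t$ a run $(P_n)_{n\ge0}=(P_n^{\delta t,\Delta t})_{n\ge 0}$ is given. Then $$\lim_{\delta t\downarrow 0}\ \lim_{\Delta t\downarrow\delta t}\ \mathcal D\big(P_{\lfloor T/\Delta t\rfloor}\,\|\,P_T\big)=0,$$ where the inner limit exists for all sufficiently small $\delta t>0$. Consequently, the laws $P_{\lfloor T/\Delta t\rfloor}$ converge to $P_T$ in total variation in the same iterated limit, i.e. $\lim_{\delta t\downarrow0}\lim_{\Delta t\downarrow\delta t}\sup_{E}|P_{\lfloor T/\Delta t\rfloor}(E)-P_T(E)|=0$,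 the supremum being over Borel sets $E\subseteq\mathbb R^d$. -/

import Mathlib

open MeasureTheory ProbabilityTheory Filter Topology Matrix
open scoped NNReal ENNReal

namespace MicroMacro

noncomputable section

/-- Euclidean space `ℝᵏ`. -/
abbrev Vec (k : ℕ) : Type := EuclideanSpace ℝ (Fin k)

/-- The process `W` is a standard `m`-dimensional Wiener process: its coordinates are
mutually independent standard real Brownian motions (with almost surely continuous paths). -/
structure IsWienerProcess {Ω : Type*} [MeasurableSpace Ω] (μ : Measure Ω) {m : ℕ}
    (W : ℝ≥0 → Ω → Vec m) : Prop where
  brownian : ∀ j : Fin m, IsBrownianReal (fun t ω => W t ω j) μ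
  indep : iIndepFun (fun (j : Fin m) (ω : Ω) (t : ℝ≥0) => W t ω j) μ

/-- `X` solves `dX = A X dt + B dW` with initial law `P₀`. As the noise is additive, the
equation means `X_t = X_0 + ∫₀ᵗ A X_s ds + B W_t` for all `t`, almost surely, where `W` is a
Wiener process independent of `X_0` and `X` has continuous paths. -/
structure IsLinearSDESolution {Ω : Type*} [MeasurableSpace Ω] (μ : Measure Ω) {d m : ℕ}
    (A : Matrix (Fin d) (Fin d) ℝ) (B : Matrix (Fin d) (Fin m) ℝ) (P₀ : Measure (Vec d))
    (W : ℝ≥0 → Ω → Vec m) (X : ℝ≥0 → Ω → Vec d) : Prop where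
  wiener : IsWienerProcess μ W
  measurable : ∀ t, AEMeasurable (X t) μ
  initial_law : μ.map (X 0) = P₀
  indep : IndepFun (X 0) (fun (ω : Ω) (t : ℝ≥0) => W t ω) μ
  continuous_paths : ∀ᵐ ω ∂μ, Continuous (fun t => X t ω)
  equation : ∀ᵐ ω ∂μ, ∀ t : ℝ≥0,
    X t ω = X 0 ω + (∫ s in (0 : ℝ)..t, toEuclideanLin A (X s.toNNReal ω))
      + toEuclideanLin B (W t ω)

/-- The covariance matrix of `P` is positive definite: `vᵀ Cov(P) v > 0` for all `v ≠ 0`. -/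
def IsNondegenerate {k : ℕ} (P : Measure (Vec k)) : Prop :=
  ∀ v : Vec k, v ≠ 0 → 0 < Var[fun x => inner ℝ v x; P]

/-- Law after one Euler–Maruyama step of size `δ` from the law `P`: the law of
`(I + δ A) X + √δ B ξ`, where `X ∼ P` and `ξ ∼ N(0, I)` are independent. -/
def eulerMaruyamaStep {d m : ℕ} (A : Matrix (Fin d) (Fin d) ℝ) (B : Matrix (Fin d) (Fin m) ℝ)
    (δ : ℝ) (P : Measure (Vec d)) : Measure (Vec d) :=
  (P.prod (stdGaussian (Vec m))).map
    (fun z => z.1 + δ • toEuclideanLin A z.1 + Real.sqrt δ • toEuclideanLin B z.2)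

/-- The restriction operator: the slow mean `E_P[Πˢ]`. -/
def slowMean {d ds : ℕ} (S : Matrix (Fin ds) (Fin d) ℝ) (P : Measure (Vec d)) : Vec ds :=
  ∫ x, toEuclideanLin S x ∂P

/-- Probability laws for which the slow mean exists and equals `a`. -/
structure HasSlowMean {d ds : ℕ} (S : Matrix (Fin ds) (Fin d) ℝ) (a : Vec ds)
    (Q : Measure (Vec d)) : Prop where
  prob : IsProbabilityMeasure Q
  integrable : Integrable (fun x => toEuclideanLin S x) Q
  mean_eq : slowMean S Q = a

/-- `Q` is the matching of the prior `P` with the slow mean `a`: it minimizes the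
Kullback–Leibler divergence `D(· ‖ P)` over all laws with slow mean `a`, the minimum being
finite. -/
structure IsMatching {d ds : ℕ} (S : Matrix (Fin ds) (Fin d) ℝ) (a : Vec ds)
    (P Q : Measure (Vec d)) : Prop where
  feasible : HasSlowMean S a Q
  finite : InformationTheory.klDiv Q P ≠ ∞
  minimal : ∀ Q' : Measure (Vec d), HasSlowMean S a Q' →
    InformationTheory.klDiv Q P ≤ InformationTheory.klDiv Q' P

/-- Linear extrapolation over a step `Δ` of the slow mean, from its values for the laws `P` at
time `0` and `P₁` at time `δ`. -/
def extrapolatedMean {d ds : ℕ} (S : Matrix (Fin ds) (Fin d) ℝ) (δ Δ : ℝ)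
    (P P₁ : Measure (Vec d)) : Vec ds :=
  slowMean S P + (Δ / δ) • (slowMean S P₁ - slowMean S P)

/-- `P 0, P 1, …` are the laws generated by micro-macro acceleration with one inner
Euler–Maruyama step of size `δ`, extrapolation step `Δ` and initial law `P₀`. -/
structure IsMicroMacroRun {d m ds : ℕ} (A : Matrix (Fin d) (Fin d) ℝ)
    (B : Matrix (Fin d) (Fin m) ℝ) (S : Matrix (Fin ds) (Fin d) ℝ) (P₀ : Measure (Vec d))
    (δ Δ : ℝ) (P : ℕ → Measure (Vec d)) : Prop where
  init : P 0 = P₀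
  step : ∀ n, IsMatching S
    (extrapolatedMean S δ Δ (P n) (eulerMaruyamaStep A B δ (P n)))
    (eulerMaruyamaStep A B δ (P n)) (P (n + 1))

/-- Total variation distance `sup_s |P(s) - Q(s)|` over measurable sets (intended for
probability measures). -/
def tvDist {k : ℕ} (P Q : Measure (Vec k)) : ℝ :=
  ⨆ s : {s : Set (Vec k) // MeasurableSet s}, |P.real s.1 - Q.real s.1|

/-- The iterated limit `lim_{δ ↓ 0} lim_{Δ ↓ δ} F δ Δ = c`: the inner limits exist for all
sufficiently small `δ > 0`, and they converge to `c`. -/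
def IteratedLimit {α : Type*} [TopologicalSpace α] (F : ℝ → ℝ → α) (c : α) : Prop :=
  ∃ L : ℝ → α, (∀ᶠ δ in 𝓝[>] (0 : ℝ), Tendsto (F δ) (𝓝[>] δ) (𝓝 (L δ))) ∧
    Tendsto L (𝓝[>] (0 : ℝ)) (𝓝 c)

end

end MicroMacro

set_option linter.unusedSectionVars false

namespace MicroMacro

/-! ### Gaussian laws on a Euclidean space -/

section Gaussian

-- Everything stays Gaussian. Tilting a Gaussian law `P` by the exponential of a linear form only
-- translates it by a covariance vector (`tilted_inner_eq_map_add`). By the Pythagorean identity for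
-- the divergence (`toReal_klDiv_eq_add_tilted`), the matching of a Gaussian prior with slow mean
-- `a` is therefore its translate by `Cov Sᵀ l`, where `S Cov Sᵀ l` is the gap between `a` and the
-- prior's slow mean. So a run has exactly the covariances of the Euler–Maruyama scheme; only its
-- means differ.
--
-- Existence and uniqueness: if the prior is nondegenerate and `S Sᵀ = 1`, then `S Cov Sᵀ` is
-- invertible, so `l` exists and is unique. For small `δ` nondegeneracy is preserved by a step, or
-- created by it when `B Bᵀ` is positive definite.
--
-- Inner limit: for `Δ` slightly above `δ` the number of steps is a constant `numSteps T δ`, and the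
-- gap in each matching carries the factor `Δ / δ - 1`. The translation is a linear function of the
-- gap, fixed as `Δ` varies, so the means converge to those of the Euler–Maruyama law
-- (`momentsTendsto_run`). This also covers singular covariances, where feasibility of the matching
-- supplies `l` (`exists_slowCov_eq`).
--
-- Outer limit: the Euler–Maruyama law is the law of an Euler scheme driven by the same Wiener path
-- as `X`. A discrete Gronwall estimate gives almost sure convergence to `X T`, hence convergence of
-- characteristic functions, which for Gaussian laws with convergent means forces a Gaussian limit
-- and convergence of covariances (`momentsTendsto_of_charFun`).
--
-- Both limits pass to the divergence because it is continuous in the mean and covariance of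
-- nondegenerate Gaussian laws (`MomentsTendsto.tendsto_klDiv`). Total variation follows from a
-- Pinsker-type bound.

/-- Real random variables with equal, everywhere finite, moment-generating functions have the
same law. -/
lemma map_eq_map_of_mgf_eq {Ω Ω' : Type*} {mΩ : MeasurableSpace Ω} {mΩ' : MeasurableSpace Ω'}
    {P : Measure Ω} {Q : Measure Ω'} [IsProbabilityMeasure P] [IsProbabilityMeasure Q]
    {X : Ω → ℝ} {Y : Ω' → ℝ} (hX : AEMeasurable X P) (hY : AEMeasurable Y Q)
    (hint : ∀ s : ℝ, Integrable (fun ω => Real.exp (s * X ω)) P) (h : mgf X P = mgf Y Q) :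
    P.map X = Q.map Y := by
  refine Measure.ext_of_complexMGF_eq hX hY (funext fun z => eqOn_complexMGF_of_mgf h ?_)
  have : integrableExpSet X P = Set.univ := Set.eq_univ_of_forall hint
  simp [this]

variable {E : Type*} [NormedAddCommGroup E] [InnerProductSpace ℝ E] [FiniteDimensional ℝ E]
  [MeasurableSpace E] [BorelSpace E]
variable {P Q : Measure E}

lemma map_inner_eq_gaussianReal [IsGaussian P] (t : E) :
    P.map (fun x => inner ℝ t x) =
      gaussianReal (inner ℝ t (∫ x, x ∂P)) (covarianceBilin P t t).toNNReal := by
  have h := IsGaussian.map_eq_gaussianReal (μ := P) (innerSL ℝ t)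
  rw [IsGaussian.integral_dual] at h
  rw [covarianceBilin_self IsGaussian.memLp_two_id]
  exact h

lemma integrable_exp_inner [IsGaussian P] (v : E) :
    Integrable (fun x => Real.exp (inner ℝ v x)) P := by
  have h := mgf_gaussianReal (map_inner_eq_gaussianReal (P := P) v) 1
  have h2 : 0 < mgf (fun x => inner ℝ v x) P 1 := by rw [h]; positivity
  simpa using mgf_pos_iff.1 h2

lemma integral_exp_inner [IsGaussian P] (v : E) :
    ∫ x, Real.exp (inner ℝ v x) ∂P =
      Real.exp (inner ℝ v (∫ x, x ∂P) + covarianceBilin P v v / 2) := by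
  have h := mgf_gaussianReal (map_inner_eq_gaussianReal (P := P) v) 1
  simpa [mgf, Real.coe_toNNReal _ (covarianceBilin_self_nonneg v)] using h

lemma eq_of_covarianceBilin_self [IsGaussian P] [IsGaussian Q]
    (hm : ∫ x, x ∂P = ∫ x, x ∂Q) (hc : ∀ t, covarianceBilin P t t = covarianceBilin Q t t) :
    P = Q := by
  apply Measure.ext_of_charFun
  ext t
  rw [IsGaussian.charFun_eq', IsGaussian.charFun_eq', hc]
  simp only [id_eq, hm]

/-- A symmetric bilinear form is determined by its quadratic form. -/
lemma covarianceBilin_eq_of_self (hc : ∀ t, covarianceBilin P t t = covarianceBilin Q t t) :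
    covarianceBilin P = covarianceBilin Q := by
  ext x y
  have h := hc (x + y)
  simp only [map_add, _root_.add_apply, hc x, hc y, covarianceBilin_comm y x] at h
  linarith

/-- Polarization: convergence of variances in all directions gives convergence of every covariance
entry. -/
lemma covarianceBilin_eq_quarter (P : Measure E) (x y : E) :
    covarianceBilin P x y =
      (covarianceBilin P (x + y) (x + y) - covarianceBilin P (x - y) (x - y)) / 4 := by
  simp only [map_add, map_sub, _root_.add_apply, _root_.sub_apply,
    covarianceBilin_comm y x]
  ring

/-- The covariance of `P` as an operator: `⟪covOp P v, t⟫ = Cov_P(⟪v, ·⟫, ⟪t, ·⟫)`. -/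
noncomputable def covOp (P : Measure E) : E →L[ℝ] E :=
  InnerProductSpace.continuousLinearMapOfBilin (covarianceBilin P)

lemma inner_covOp (P : Measure E) (v t : E) :
    inner ℝ (covOp P v) t = covarianceBilin P v t :=
  InnerProductSpace.continuousLinearMapOfBilin_apply _ v t

lemma inner_covOp' (P : Measure E) (v t : E) :
    inner ℝ t (covOp P v) = covarianceBilin P v t := by
  rw [real_inner_comm, inner_covOp]

lemma integral_id_map_add_const [IsGaussian P] (c : E) :
    ∫ x, x ∂(P.map (fun x => x + c)) = ∫ x, x ∂P + c := by
  rw [integral_map (by fun_prop) (by fun_prop), integral_add IsGaussian.integrable_fun_id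
    (integrable_const _)]
  simp

lemma covarianceBilin_map_add_const [IsProbabilityMeasure P] (c : E) :
    covarianceBilin (P.map (fun x => x + c)) = covarianceBilin P := by
  simp_rw [add_comm _ c]
  exact covarianceBilin_map_const_add c

/-- Exponential tilting of a Gaussian law by a linear form is a translation by a covariance
vector. -/
lemma tilted_inner_eq_map_add [IsGaussian P] (v : E) :
    P.tilted (fun x => inner ℝ v x) = P.map (fun x => x + covOp P v) := by
  have hT : IsProbabilityMeasure (P.tilted (fun x => inner ℝ v x)) :=
    isProbabilityMeasure_tilted (integrable_exp_inner v)
  apply Measure.ext_of_charFunDual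
  ext L
  rw [charFunDual_eq_charFun_map_one, charFunDual_eq_charFun_map_one]
  congr 1
  obtain ⟨t, rfl⟩ := (InnerProductSpace.toDual ℝ E).surjective L
  simp only [InnerProductSpace.toDual_apply_eq_toDualMap_apply]
  -- One-dimensional marginals suffice. Completing the square in the Gaussian exponent leaves the
  -- cross term `s Cov(v, t)`, which is the shift of the mean.
  refine map_eq_map_of_mgf_eq (by fun_prop) (by fun_prop) (fun s => ?_) ?_
  · rw [integrable_tilted_iff (integrable_exp_inner v)]
    refine (integrable_exp_inner (P := P) (v + s • t)).congr (ae_of_all _ fun x => ?_)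
    simp [inner_add_left, inner_smul_left, Real.exp_add]
  · ext s
    rw [mgf, mgf, integral_map (by fun_prop) (by fun_prop)]
    have h := integral_exp_tilted (μ := P) (fun x => inner ℝ v x) (fun x => inner ℝ (s • t) x)
    simp only [InnerProductSpace.toDualMap_apply_apply]
    have h1 : ∀ x, s * inner ℝ t x = inner ℝ (s • t) x := fun x => by simp [inner_smul_left]
    simp only [h1]
    rw [h]
    simp only [Pi.add_apply, ← inner_add_left, inner_add_right, Real.exp_add, integral_mul_const]
    rw [integral_exp_inner, integral_exp_inner, integral_exp_inner, ← Real.exp_sub,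
      ← Real.exp_add]
    congr 1
    rw [inner_covOp']
    simp only [map_add, _root_.add_apply, covarianceBilin_comm (s • t) v,
      inner_add_left]
    ring

end Gaussian

/-! ### The Kullback–Leibler divergence and exponential tilting -/

section Tilting

variable {α : Type*} {mα : MeasurableSpace α} {P Q : Measure α} {f : α → ℝ}
open InformationTheory

lemma klDiv_tilted_ne_top [IsProbabilityMeasure P] [IsProbabilityMeasure Q]
    (hf : Integrable (fun x => Real.exp (f x)) P) (hfQ : Integrable f Q)
    (hQ : klDiv Q P ≠ ∞) : klDiv Q (P.tilted f) ≠ ∞ := by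
  rw [klDiv_ne_top_iff] at hQ ⊢
  exact ⟨hQ.1.trans (absolutelyContinuous_tilted hf), integrable_llr_tilted_right hQ.1 hfQ hQ.2 hf⟩

/-- Tilting changes the log-density by `f` minus its log-normalizer; integrating against `Q` gives
an affine correction. -/
lemma toReal_klDiv_tilted_right [IsProbabilityMeasure P] [IsProbabilityMeasure Q]
    (hf : Integrable (fun x => Real.exp (f x)) P) (hfQ : Integrable f Q)
    (hQ : klDiv Q P ≠ ∞) :
    (klDiv Q (P.tilted f)).toReal =
      (klDiv Q P).toReal - ∫ x, f x ∂Q + Real.log (∫ x, Real.exp (f x) ∂P) := by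
  have hT : IsProbabilityMeasure (P.tilted f) := isProbabilityMeasure_tilted hf
  have hQ' := hQ
  rw [klDiv_ne_top_iff] at hQ'
  rw [toReal_klDiv_of_measure_eq (hQ'.1.trans (absolutelyContinuous_tilted hf)) (by simp),
    toReal_klDiv_of_measure_eq hQ'.1 (by simp), integral_llr_tilted_right hQ'.1 hfQ hf hQ'.2]

lemma klDiv_tilted_self_ne_top [IsProbabilityMeasure P]
    (hf : Integrable (fun x => Real.exp (f x)) P) (hfT : Integrable f (P.tilted f)) :
    klDiv (P.tilted f) P ≠ ∞ := by
  have hT : IsProbabilityMeasure (P.tilted f) := isProbabilityMeasure_tilted hf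
  refine klDiv_ne_top (tilted_absolutelyContinuous P f) ?_
  have h : llr (P.tilted f) P =ᵐ[P.tilted f] fun x => f x - Real.log (∫ x, Real.exp (f x) ∂P) :=
    (tilted_absolutelyContinuous P f).ae_le (log_rnDeriv_tilted_left_self hf)
  exact (hfT.sub (integrable_const (Real.log (∫ x, Real.exp (f x) ∂P)))).congr h.symm

/-- The Pythagorean identity: among the laws with a given mean of `f`, the tilted law is the
projection of `P`. -/
lemma toReal_klDiv_eq_add_tilted [IsProbabilityMeasure P] [IsProbabilityMeasure Q]
    (hf : Integrable (fun x => Real.exp (f x)) P) (hfT : Integrable f (P.tilted f))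
    (hfQ : Integrable f Q) (hmean : ∫ x, f x ∂Q = ∫ x, f x ∂(P.tilted f))
    (hQ : klDiv Q P ≠ ∞) :
    (klDiv Q P).toReal = (klDiv Q (P.tilted f)).toReal + (klDiv (P.tilted f) P).toReal := by
  have hT : IsProbabilityMeasure (P.tilted f) := isProbabilityMeasure_tilted hf
  -- The tilting formula is applied to `Q` and to the tilted law itself. The two integrals of `f`
  -- agree, so the difference eliminates both them and the normalizer.
  have h1 := toReal_klDiv_tilted_right hf hfQ hQ
  have h2 := toReal_klDiv_tilted_right hf hfT (klDiv_tilted_self_ne_top hf hfT)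
  rw [klDiv_self] at h2
  simp only [ENNReal.toReal_zero] at h2
  linarith

end Tilting

end MicroMacro

namespace MicroMacro

/-! ### Matching a Gaussian prior -/

section Matching

open InformationTheory

/-- The continuous linear map of Euclidean spaces with matrix `M`. -/
noncomputable def toCLM {k l : ℕ} (M : Matrix (Fin k) (Fin l) ℝ) : Vec l →L[ℝ] Vec k :=
  (toEuclideanLin M).toContinuousLinearMap

lemma toCLM_apply {k l : ℕ} (M : Matrix (Fin k) (Fin l) ℝ) (x : Vec l) :
    toEuclideanLin M x = toCLM M x := rfl

lemma adjoint_toCLM {k l : ℕ} (M : Matrix (Fin k) (Fin l) ℝ) :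
    (toCLM M).adjoint = toCLM Mᵀ := by
  ext1 y
  refine ext_inner_left ℝ fun x => ?_
  rw [ContinuousLinearMap.adjoint_inner_right, ← toCLM_apply, ← toCLM_apply]
  simp only [toLpLin_apply, EuclideanSpace.inner_eq_star_dotProduct, star_trivial]
  rw [Matrix.dotProduct_mulVec, Matrix.mulVec_transpose]

variable {d ds : ℕ} (S : Matrix (Fin ds) (Fin d) ℝ) {a : Vec ds} {P Q : Measure (Vec d)}

/-- The covariance operator of the slow variables. -/
noncomputable def slowCov (P : Measure (Vec d)) : Vec ds →L[ℝ] Vec ds :=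
  toCLM S ∘L covOp P ∘L (toCLM S).adjoint

lemma slowCov_apply (P : Measure (Vec d)) (l : Vec ds) :
    slowCov S P l = toCLM S (covOp P ((toCLM S).adjoint l)) := rfl

lemma inner_slowCov (P : Measure (Vec d)) (l k : Vec ds) :
    inner ℝ (slowCov S P l) k =
      covarianceBilin P ((toCLM S).adjoint l) ((toCLM S).adjoint k) := by
  rw [slowCov_apply, ← inner_covOp, ContinuousLinearMap.adjoint_inner_right]

lemma slowMean_eq [IsGaussian P] : slowMean S P = toCLM S (∫ x, x ∂P) :=
  (toCLM S).integral_comp_comm IsGaussian.integrable_fun_id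

lemma HasSlowMean.integrable_inner (h : HasSlowMean S a Q) (l : Vec ds) :
    Integrable (fun x => inner ℝ ((toCLM S).adjoint l) x) Q := by
  simp_rw [ContinuousLinearMap.adjoint_inner_left]
  exact h.integrable.const_inner l

lemma HasSlowMean.integral_inner (h : HasSlowMean S a Q) (l : Vec ds) :
    ∫ x, inner ℝ ((toCLM S).adjoint l) x ∂Q = inner ℝ l a := by
  simp_rw [ContinuousLinearMap.adjoint_inner_left]
  rw [← h.mean_eq]
  exact _root_.integral_inner h.integrable l

lemma hasSlowMean_of_isGaussian [IsGaussian Q] (h : toCLM S (∫ x, x ∂Q) = a) :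
    HasSlowMean S a Q where
  prob := inferInstance
  integrable := (toCLM S).integrable_comp IsGaussian.integrable_fun_id
  mean_eq := by rw [slowMean_eq, h]

lemma hasSlowMean_translate [IsGaussian P] {l : Vec ds}
    (hl : slowCov S P l = a - toCLM S (∫ x, x ∂P)) :
    HasSlowMean S a (P.map (fun x => x + covOp P ((toCLM S).adjoint l))) := by
  apply hasSlowMean_of_isGaussian
  rw [integral_id_map_add_const, map_add, ← slowCov_apply, hl]
  abel

lemma klDiv_translate_ne_top [IsGaussian P] (v : Vec d) :
    klDiv (P.map (fun x => x + covOp P v)) P ≠ ∞ := by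
  rw [← tilted_inner_eq_map_add]
  refine klDiv_tilted_self_ne_top (integrable_exp_inner v) ?_
  rw [tilted_inner_eq_map_add]
  exact IsGaussian.integrable_dual _ (innerSL ℝ v)

lemma toReal_klDiv_eq_add_translate [IsGaussian P] {l : Vec ds}
    (hl : slowCov S P l = a - toCLM S (∫ x, x ∂P)) (hQ : HasSlowMean S a Q)
    (hfin : klDiv Q P ≠ ∞) :
    (klDiv Q P).toReal =
      (klDiv Q (P.map (fun x => x + covOp P ((toCLM S).adjoint l)))).toReal +
      (klDiv (P.map (fun x => x + covOp P ((toCLM S).adjoint l))) P).toReal := by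
  have := hQ.prob
  have h := hasSlowMean_translate S hl
  have h1 := h.integrable_inner S l
  have h2 := h.integral_inner S l
  rw [← tilted_inner_eq_map_add] at h1 h2 ⊢
  exact toReal_klDiv_eq_add_tilted (integrable_exp_inner _) h1 (hQ.integrable_inner S l)
    ((hQ.integral_inner S l).trans h2.symm) hfin

/-- By the Pythagorean identity every feasible competitor of finite divergence exceeds the translate
by a nonnegative divergence. -/
lemma isMatching_translate [IsGaussian P] {l : Vec ds}
    (hl : slowCov S P l = a - toCLM S (∫ x, x ∂P)) :
    IsMatching S a P (P.map (fun x => x + covOp P ((toCLM S).adjoint l))) where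
  feasible := hasSlowMean_translate S hl
  finite := klDiv_translate_ne_top _
  minimal Q' hQ' := by
    by_cases hfin : klDiv Q' P = ∞
    · rw [hfin]; exact le_top
    rw [← ENNReal.toReal_le_toReal (klDiv_translate_ne_top _) hfin,
      toReal_klDiv_eq_add_translate S hl hQ' hfin]
    exact le_add_of_nonneg_left ENNReal.toReal_nonneg

/-- Minimality makes the excess in the Pythagorean identity vanish, and a zero divergence identifies
the laws. -/
lemma IsMatching.eq_translate [IsGaussian P] {l : Vec ds} (h : IsMatching S a P Q)
    (hl : slowCov S P l = a - toCLM S (∫ x, x ∂P)) :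
    Q = P.map (fun x => x + covOp P ((toCLM S).adjoint l)) := by
  have := h.feasible.prob
  have hpy := toReal_klDiv_eq_add_translate S hl h.feasible h.finite
  have hmin := ENNReal.toReal_mono (klDiv_translate_ne_top _)
    (h.minimal _ (hasSlowMean_translate S hl))
  have h0 : (klDiv Q (P.map (fun x => x + covOp P ((toCLM S).adjoint l)))).toReal = 0 :=
    le_antisymm (by linarith) ENNReal.toReal_nonneg
  have hne : klDiv Q (P.map (fun x => x + covOp P ((toCLM S).adjoint l))) ≠ ∞ := by
    rw [← tilted_inner_eq_map_add]
    exact klDiv_tilted_ne_top (integrable_exp_inner _) (h.feasible.integrable_inner S l) h.finite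
  rw [ENNReal.toReal_eq_zero_iff] at h0
  exact klDiv_eq_zero_iff.1 (h0.resolve_right hne)

/-- A Gaussian law is almost surely constant in the directions of variance zero. -/
lemma ae_inner_eq_of_variance_eq_zero [IsGaussian P] {v : Vec d}
    (hv : covarianceBilin P v v = 0) : ∀ᵐ x ∂P, inner ℝ v x = inner ℝ v (∫ x, x ∂P) := by
  have h := map_inner_eq_gaussianReal (P := P) v
  rw [hv, Real.toNNReal_zero, gaussianReal_zero_var] at h
  have h2 : ∀ᵐ y ∂(P.map (fun x => inner ℝ v x)), y = inner ℝ v (∫ x, x ∂P) := by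
    rw [h, ae_dirac_eq]
    exact rfl
  exact ae_of_ae_map (by fun_prop) h2

/-- For a singular covariance, solvability comes from feasibility. The operator is symmetric, so its
range is the orthogonal complement of its kernel. A kernel vector `w` makes `Sᵀ w` a direction of
zero variance, in which `P`, and hence `Q ≪ P`, is almost surely constant; the two slow means then
agree along `w`. -/
lemma exists_slowCov_eq [IsGaussian P] (h : HasSlowMean S a Q) (hQ : Q ≪ P) :
    ∃ l, slowCov S P l = a - toCLM S (∫ x, x ∂P) := by
  have := h.prob
  have hsym : (slowCov S P).toLinearMap.IsSymmetric := fun x y => by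
    simp only [ContinuousLinearMap.coe_coe]
    rw [inner_slowCov, ← real_inner_comm x, inner_slowCov, covarianceBilin_comm]
  suffices hmem : a - toCLM S (∫ x, x ∂P) ∈ (slowCov S P).toLinearMap.range from hmem
  rw [← Submodule.orthogonal_orthogonal (slowCov S P).toLinearMap.range, hsym.orthogonal_range]
  intro w hw
  have hw0 : slowCov S P w = 0 := hw
  have hvar : covarianceBilin P ((toCLM S).adjoint w) ((toCLM S).adjoint w) = 0 := by
    rw [← inner_slowCov, hw0, inner_zero_left]
  have hae := hQ.ae_le (ae_inner_eq_of_variance_eq_zero hvar)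
  have h1 := h.integral_inner S w
  rw [integral_congr_ae hae] at h1
  simp only [integral_const, probReal_univ, smul_eq_mul, one_mul,
    ContinuousLinearMap.adjoint_inner_left] at h1
  rw [inner_sub_right, h1, sub_self]

/-- The matching of a Gaussian prior is a translate of the prior. -/
lemma IsMatching.exists_translate [IsGaussian P] (h : IsMatching S a P Q) :
    ∃ l, slowCov S P l = a - toCLM S (∫ x, x ∂P) ∧
      Q = P.map (fun x => x + covOp P ((toCLM S).adjoint l)) := by
  obtain ⟨l, hl⟩ := exists_slowCov_eq S h.feasible (klDiv_ne_top_iff.1 h.finite).1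
  exact ⟨l, hl, h.eq_translate S hl⟩

lemma IsMatching.isGaussian [IsGaussian P] (h : IsMatching S a P Q) : IsGaussian Q := by
  obtain ⟨l, -, rfl⟩ := h.exists_translate
  infer_instance

lemma IsMatching.covarianceBilin_eq [IsGaussian P] (h : IsMatching S a P Q) :
    covarianceBilin Q = covarianceBilin P := by
  obtain ⟨l, -, rfl⟩ := h.exists_translate
  exact covarianceBilin_map_add_const _

/-- A nondegenerate Gaussian prior has exactly one matching with every slow mean. -/
lemma existsUnique_isMatching [IsGaussian P] (hS : S * Sᵀ = 1)
    (hP : ∀ v, v ≠ 0 → 0 < covarianceBilin P v v) (a : Vec ds) :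
    ∃! Q, IsMatching S a P Q := by
  -- `S Sᵀ = 1` makes `S` a left inverse of `Sᵀ`, so the quadratic form of `slowCov S P` is positive
  -- on nonzero vectors.
  have hinj : Function.Injective (toCLM S).adjoint := by
    refine Function.LeftInverse.injective (g := toCLM S) fun l => ?_
    rw [adjoint_toCLM, ← toCLM_apply, ← toCLM_apply]
    simp [toLpLin_apply, Matrix.mulVec_mulVec, hS]
  have hker : Function.Injective (slowCov S P).toLinearMap := by
    rw [← LinearMap.ker_eq_bot, LinearMap.ker_eq_bot']
    intro l hl
    by_contra hne
    have h1 := hP _ ((map_ne_zero_iff _ hinj).2 hne)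
    rw [← inner_slowCov] at h1
    have : slowCov S P l = 0 := hl
    simp [this] at h1
  obtain ⟨l, hl⟩ := LinearMap.injective_iff_surjective.1 hker (a - toCLM S (∫ x, x ∂P))
  exact ⟨_, isMatching_translate S hl, fun Q hQ => hQ.eq_translate S hl⟩

end Matching

end MicroMacro

namespace MicroMacro

/-! ### The Euler–Maruyama step -/

section EulerMaruyama

variable {d m ds : ℕ} (A : Matrix (Fin d) (Fin d) ℝ) (B : Matrix (Fin d) (Fin m) ℝ)
  (S : Matrix (Fin ds) (Fin d) ℝ) (δ : ℝ) {P : Measure (Vec d)}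

/-- The linear part `I + δ A` of the Euler–Maruyama step. -/
noncomputable def stepCLM : Vec d →L[ℝ] Vec d := ContinuousLinearMap.id ℝ _ + δ • toCLM A

lemma stepCLM_apply (x : Vec d) : stepCLM A δ x = x + δ • toCLM A x := rfl

/-- The Euler–Maruyama step as a linear image of the joint law of position and noise. -/
noncomputable def emCLM : Vec d × Vec m →L[ℝ] Vec d :=
  stepCLM A δ ∘L ContinuousLinearMap.fst ℝ _ _ +
    (Real.sqrt δ • toCLM B) ∘L ContinuousLinearMap.snd ℝ _ _

lemma emCLM_apply (z : Vec d × Vec m) :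
    emCLM A B δ z = stepCLM A δ z.1 + Real.sqrt δ • toCLM B z.2 := rfl

lemma eulerMaruyamaStep_eq (P : Measure (Vec d)) :
    eulerMaruyamaStep A B δ P = (P.prod (stdGaussian (Vec m))).map (emCLM A B δ) := rfl

instance isGaussian_eulerMaruyamaStep [IsGaussian P] :
    IsGaussian (eulerMaruyamaStep A B δ P) := by
  rw [eulerMaruyamaStep_eq]
  infer_instance

lemma integral_eulerMaruyamaStep [IsGaussian P] :
    ∫ x, x ∂(eulerMaruyamaStep A B δ P) = stepCLM A δ (∫ x, x ∂P) := by
  rw [eulerMaruyamaStep_eq, integral_map (by fun_prop) (by fun_prop)]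
  simp only [emCLM_apply]
  have h1 : Integrable (fun x : Vec d => stepCLM A δ x) P :=
    (stepCLM A δ).integrable_comp IsGaussian.integrable_fun_id
  have h2 : Integrable (fun y : Vec m => Real.sqrt δ • toCLM B y) (stdGaussian (Vec m)) :=
    (Real.sqrt δ • toCLM B).integrable_comp IsGaussian.integrable_fun_id
  rw [integral_add (h1.comp_fst _) (h2.comp_snd _), integral_fun_fst (fun x => stepCLM A δ x),
    integral_fun_snd (fun y => Real.sqrt δ • toCLM B y),
    ContinuousLinearMap.integral_comp_comm _ IsGaussian.integrable_fun_id,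
    integral_smul, ContinuousLinearMap.integral_comp_comm _ IsGaussian.integrable_fun_id,
    integral_id_stdGaussian]
  simp

lemma covarianceBilin_eulerMaruyamaStep [IsGaussian P] (hδ : 0 ≤ δ) (t : Vec d) :
    covarianceBilin (eulerMaruyamaStep A B δ P) t t =
      covarianceBilin P ((stepCLM A δ).adjoint t) ((stepCLM A δ).adjoint t) +
        δ * ‖(toCLM B).adjoint t‖ ^ 2 := by
  rw [covarianceBilin_self IsGaussian.memLp_two_id, covarianceBilin_self IsGaussian.memLp_two_id,
    eulerMaruyamaStep_eq, variance_map (by fun_prop) (by fun_prop)]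
  have h : ((fun u => inner ℝ t u) ∘ emCLM A B δ) = fun z : Vec d × Vec m =>
      inner ℝ ((stepCLM A δ).adjoint t) z.1 +
        inner ℝ (Real.sqrt δ • (toCLM B).adjoint t) z.2 := by
    ext z
    simp [emCLM_apply, inner_add_right, ContinuousLinearMap.adjoint_inner_left,
      inner_smul_left, inner_smul_right]
  rw [h, variance_add_prod (X := fun x : Vec d => inner ℝ ((stepCLM A δ).adjoint t) x)
    (Y := fun y : Vec m => inner ℝ (Real.sqrt δ • (toCLM B).adjoint t) y)
    (IsGaussian.memLp_dual P (innerSL ℝ _) 2 (by simp))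
    (IsGaussian.memLp_dual _ (innerSL ℝ _) 2 (by simp))]
  congr 1
  have := variance_dual_stdGaussian (innerSL ℝ (Real.sqrt δ • (toCLM B).adjoint t))
  simp only [innerSL_apply_norm, norm_smul, mul_pow, Real.norm_eq_abs, sq_abs,
    Real.sq_sqrt hδ] at this
  exact this

lemma isNondegenerate_iff [IsGaussian P] :
    IsNondegenerate P ↔ ∀ v, v ≠ 0 → 0 < covarianceBilin P v v := by
  simp only [IsNondegenerate, covarianceBilin_self IsGaussian.memLp_two_id]

lemma adjoint_stepCLM_apply (t : Vec d) :
    (stepCLM A δ).adjoint t = t + δ • (toCLM A).adjoint t := by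
  refine ext_inner_right ℝ fun x => ?_
  simp [stepCLM_apply, ContinuousLinearMap.adjoint_inner_left, inner_add_left, inner_add_right,
    inner_smul_left, inner_smul_right]

/-- If `t + δ Aᵀ t = 0` then `‖t‖ ≤ δ ‖Aᵀ‖ ‖t‖`, which forces `t = 0` once `δ ‖Aᵀ‖ < 1`. -/
lemma eventually_adjoint_stepCLM_ne_zero :
    ∀ᶠ δ in 𝓝[>] (0 : ℝ), ∀ t : Vec d, t ≠ 0 → (stepCLM A δ).adjoint t ≠ 0 := by
  have hlim : Tendsto (fun δ : ℝ => δ * ‖(toCLM A).adjoint‖) (𝓝[>] 0) (𝓝 0) := by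
    have : Tendsto (fun δ : ℝ => δ * ‖(toCLM A).adjoint‖) (𝓝 0) (𝓝 (0 * ‖(toCLM A).adjoint‖)) :=
      (continuous_id.mul continuous_const).tendsto 0
    rw [zero_mul] at this
    exact this.mono_left nhdsWithin_le_nhds
  filter_upwards [hlim.eventually_lt_const one_pos, self_mem_nhdsWithin] with δ hδ hpos t ht h0
  rw [adjoint_stepCLM_apply] at h0
  have h1 : ‖t‖ = δ * ‖(toCLM A).adjoint t‖ := by
    rw [eq_neg_of_add_eq_zero_left h0, norm_neg, norm_smul, Real.norm_of_nonneg (le_of_lt hpos),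
      ← eq_neg_of_add_eq_zero_left h0]
  have h2 := (toCLM A).adjoint.le_opNorm t
  have h3 : 0 < ‖t‖ := norm_pos_iff.2 ht
  have h4 : (0 : ℝ) < δ := hpos
  nlinarith

lemma adjoint_toCLM_ne_zero {B : Matrix (Fin d) (Fin m) ℝ} (hB : (B * Bᵀ).PosDef) {t : Vec d}
    (ht : t ≠ 0) : (toCLM B).adjoint t ≠ 0 := by
  intro h0
  rw [adjoint_toCLM, ← toCLM_apply] at h0
  have h1 := hB.dotProduct_mulVec_pos (x := t.ofLp) (by simpa using ht)
  rw [← Matrix.mulVec_mulVec] at h1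
  have h2 : Bᵀ *ᵥ t.ofLp = 0 := by simpa [toLpLin_apply] using h0
  simp [h2] at h1

lemma eulerMaruyamaStep_nondegenerate [IsGaussian P] (hδ : 0 < δ)
    (hL : ∀ t : Vec d, t ≠ 0 → (stepCLM A δ).adjoint t ≠ 0)
    (h : (∀ v, v ≠ 0 → 0 < covarianceBilin P v v) ∨ (B * Bᵀ).PosDef) {v : Vec d} (hv : v ≠ 0) :
    0 < covarianceBilin (eulerMaruyamaStep A B δ P) v v := by
  rw [covarianceBilin_eulerMaruyamaStep A B δ hδ.le]
  rcases h with h | h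
  · exact add_pos_of_pos_of_nonneg (h _ (hL v hv)) (by positivity)
  · have := adjoint_toCLM_ne_zero h hv
    exact add_pos_of_nonneg_of_pos (covarianceBilin_self_nonneg _) (by positivity)

end EulerMaruyama

/-! ### Existence and uniqueness of runs -/

section Run

/-- A sequence is uniquely determined by a step relation that is uniquely solvable along an
invariant. -/
lemma existsUnique_seq {α : Type*} (R : α → α → Prop) (I : α → Prop) {x₀ : α} (h0 : I x₀)
    (hR : ∀ x, I x → ∃! y, R x y) (hI : ∀ x y, I x → R x y → I y) :
    ∃! u : ℕ → α, u 0 = x₀ ∧ ∀ n, R (u n) (u (n + 1)) := by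
  classical
  choose! F hF hFu using hR
  have hinv : ∀ u : ℕ → α, u 0 = x₀ → (∀ n, R (u n) (u (n + 1))) → ∀ n, I (u n) := by
    intro u hu hs n
    induction n with
    | zero => rwa [hu]
    | succ n ih => exact hI _ _ ih (hs n)
  have hIF : ∀ n, I (F^[n] x₀) := by
    intro n
    induction n with
    | zero => exact h0
    | succ n ih => rw [Function.iterate_succ_apply']; exact hI _ _ ih (hF _ ih)
  refine ⟨fun n => F^[n] x₀, ⟨rfl, fun n => ?_⟩, fun u ⟨hu, hs⟩ => funext fun n => ?_⟩
  · change R (F^[n] x₀) (F^[n + 1] x₀)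
    rw [Function.iterate_succ_apply']
    exact hF _ (hIF n)
  · induction n with
    | zero => exact hu
    | succ n ih =>
      rw [Function.iterate_succ_apply', ← ih]
      exact hFu _ (hinv u hu hs n) _ (hs n)

variable {d m ds : ℕ} (A : Matrix (Fin d) (Fin d) ℝ) (B : Matrix (Fin d) (Fin m) ℝ)
  (S : Matrix (Fin ds) (Fin d) ℝ) {P₀ : Measure (Vec d)}

lemma isMicroMacroRun_iff {δ Δ : ℝ} {P : ℕ → Measure (Vec d)} :
    IsMicroMacroRun A B S P₀ δ Δ P ↔ P 0 = P₀ ∧ ∀ n, IsMatching S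
      (extrapolatedMean S δ Δ (P n) (eulerMaruyamaStep A B δ (P n)))
      (eulerMaruyamaStep A B δ (P n)) (P (n + 1)) :=
  ⟨fun h => ⟨h.init, h.step⟩, fun h => ⟨h.1, h.2⟩⟩

/-- The invariant is being Gaussian together with the disjunction in the hypothesis. One step turns
either alternative into nondegeneracy, and matching keeps the covariance. -/
theorem existsUnique_isMicroMacroRun (hS : S * Sᵀ = 1) [IsGaussian P₀]
    (h : IsNondegenerate P₀ ∨ (B * Bᵀ).PosDef) :
    ∀ᶠ δ in 𝓝[>] (0 : ℝ), ∀ Δ : ℝ, ∃! P : ℕ → Measure (Vec d),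
      IsMicroMacroRun A B S P₀ δ Δ P := by
  filter_upwards [eventually_adjoint_stepCLM_ne_zero A, self_mem_nhdsWithin] with δ hL hδ Δ
  simp_rw [isMicroMacroRun_iff]
  refine existsUnique_seq
    (fun P Q => IsMatching S (extrapolatedMean S δ Δ P (eulerMaruyamaStep A B δ P))
      (eulerMaruyamaStep A B δ P) Q)
    (fun P => IsGaussian P ∧
      ((∀ v, v ≠ 0 → 0 < covarianceBilin P v v) ∨ (B * Bᵀ).PosDef)) ?_ ?_ ?_
  · exact ⟨inferInstance, h.imp_left isNondegenerate_iff.1⟩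
  · rintro P ⟨hP, hnd⟩
    exact existsUnique_isMatching S hS
      (fun v hv => eulerMaruyamaStep_nondegenerate A B δ hδ hL hnd hv) _
  · rintro P Q ⟨hP, hnd⟩ hQ
    refine ⟨hQ.isGaussian, Or.inl fun v hv => ?_⟩
    rw [hQ.covarianceBilin_eq]
    exact eulerMaruyamaStep_nondegenerate A B δ hδ hL hnd hv

end Run

end MicroMacro

namespace MicroMacro

/-! ### Densities of Gaussian laws -/

section Density

lemma map_withDensity_comp {α β : Type*} {mα : MeasurableSpace α} {mβ : MeasurableSpace β}
    (μ : Measure α) {T : α → β} (hT : Measurable T) {f : β → ℝ≥0∞} (hf : Measurable f) :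
    (μ.withDensity (f ∘ T)).map T = (μ.map T).withDensity f := by
  ext s hs
  rw [Measure.map_apply hT hs, withDensity_apply _ (hT hs), withDensity_apply _ hs,
    setLIntegral_map hs hf hT]
  rfl

/-- The normalization constant of the standard Gaussian density. -/
noncomputable def gaussianConst (d : ℕ) : ℝ :=
  (∫ v : Vec d, Real.exp (-(1 / 2) * ‖v‖ ^ 2))⁻¹

lemma gaussianConst_pos (d : ℕ) : 0 < gaussianConst d := by
  rw [gaussianConst, GaussianFourier.integral_rexp_neg_mul_sq_norm (by norm_num)]
  positivity

lemma integrable_exp_neg_half_sq_norm (d : ℕ) :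
    Integrable (fun v : Vec d => Real.exp (-(1 / 2) * ‖v‖ ^ 2)) := by
  refine Integrable.of_integral_ne_zero ?_
  have h := gaussianConst_pos d
  rw [gaussianConst, inv_pos] at h
  exact h.ne'

/-- Both sides have the same characteristic function, by the Gaussian Fourier integral. -/
lemma stdGaussian_eq_withDensity (d : ℕ) :
    stdGaussian (Vec d) = volume.withDensity
      (fun v => ENNReal.ofReal (gaussianConst d * Real.exp (-(1 / 2) * ‖v‖ ^ 2))) := by
  have hint := (integrable_exp_neg_half_sq_norm d).const_mul (gaussianConst d)
  have hfin := isFiniteMeasure_withDensity_ofReal hint.2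
  apply Measure.ext_of_charFun
  ext t
  rw [charFun_stdGaussian, charFun_apply, integral_withDensity_eq_integral_toReal_smul
    (by fun_prop) (ae_of_all _ fun _ => ENNReal.ofReal_lt_top)]
  have hnn : ∀ v : Vec d, 0 ≤ gaussianConst d * Real.exp (-(1 / 2) * ‖v‖ ^ 2) := fun v =>
    mul_nonneg (gaussianConst_pos d).le (Real.exp_nonneg _)
  have hb : (0 : ℝ) < ((1 / 2 : ℂ)).re := by norm_num
  have h1 := GaussianFourier.integral_cexp_neg_mul_sq_norm_add hb Complex.I t
  rw [← GaussianFourier.integral_cexp_neg_mul_sq_norm hb] at h1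
  have h2 : ∫ v : Vec d, Complex.exp (-(1 / 2 : ℂ) * (‖v‖ : ℂ) ^ 2) =
      ((gaussianConst d)⁻¹ : ℝ) := by
    rw [gaussianConst, inv_inv, ← integral_complex_ofReal]
    congr 1
    ext v
    push_cast
    rfl
  rw [h2] at h1
  have h3 : ∀ v : Vec d, (ENNReal.ofReal (gaussianConst d * Real.exp (-(1 / 2) * ‖v‖ ^ 2))).toReal •
      Complex.exp ((inner ℝ v t : ℝ) * Complex.I) = (gaussianConst d : ℂ) *
        Complex.exp (-(1 / 2 : ℂ) * (‖v‖ : ℂ) ^ 2 + Complex.I * (inner ℝ t v : ℝ)) := by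
    intro v
    rw [ENNReal.toReal_ofReal (hnn v), Complex.exp_add, Complex.real_smul, real_inner_comm v t]
    push_cast
    rw [mul_comm Complex.I, mul_assoc]
  simp_rw [h3]
  rw [integral_const_mul, h1]
  have h4 : (gaussianConst d : ℂ) ≠ 0 := by exact_mod_cast (gaussianConst_pos d).ne'
  push_cast
  rw [← mul_assoc, mul_inv_cancel₀ h4, one_mul, Complex.I_sq]
  congr 1
  ring

variable {d : ℕ} {P Q : Measure (Vec d)}

/-- The covariance matrix of a law. -/
noncomputable def covMatrix (P : Measure (Vec d)) : Matrix (Fin d) (Fin d) ℝ :=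
  .of fun i j => covarianceBilin P (EuclideanSpace.single i 1) (EuclideanSpace.single j 1)

lemma dotProduct_covMatrix_mulVec (P : Measure (Vec d)) (x y : Vec d) :
    x.ofLp ⬝ᵥ covMatrix P *ᵥ y.ofLp = covarianceBilin P x y := by
  have hx : ∀ x : Vec d, x = ∑ i, x i • EuclideanSpace.single i (1 : ℝ) := fun x => by
    simpa using ((EuclideanSpace.basisFun (Fin d) ℝ).sum_repr x).symm
  conv_rhs => rw [hx x, hx y]
  simp only [map_sum, map_smul, _root_.sum_apply, _root_.smul_apply, smul_eq_mul, dotProduct,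
    mulVec, covMatrix, of_apply, Finset.mul_sum]
  rw [Finset.sum_comm]
  refine Finset.sum_congr rfl fun i _ => Finset.sum_congr rfl fun j _ => ?_
  ring

lemma posSemidef_covMatrix (P : Measure (Vec d)) : (covMatrix P).PosSemidef := by
  refine Matrix.PosSemidef.of_dotProduct_mulVec_nonneg ?_ fun x => ?_
  · ext i j
    simp [covMatrix, covarianceBilin_comm]
  · have := covarianceBilin_self_nonneg (μ := P) (WithLp.toLp 2 x)
    rw [← dotProduct_covMatrix_mulVec] at this
    simpa using this

lemma posDef_covMatrix_iff (P : Measure (Vec d)) :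
    (covMatrix P).PosDef ↔ ∀ v, v ≠ 0 → 0 < covarianceBilin P v v := by
  simp_rw [← dotProduct_covMatrix_mulVec]
  constructor
  · intro h v hv
    exact h.dotProduct_mulVec_pos (x := v.ofLp) (by simpa using hv)
  · intro h
    refine Matrix.PosDef.of_dotProduct_mulVec_pos (posSemidef_covMatrix P).1 fun x hx => ?_
    exact h (WithLp.toLp 2 x) (by simpa using hx)

/-- A semidefinite matrix is definite exactly when invertible. This expresses nondegeneracy as an
open condition on a continuous function of the covariances. -/
lemma det_covMatrix_pos_iff (P : Measure (Vec d)) :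
    0 < (covMatrix P).det ↔ ∀ v, v ≠ 0 → 0 < covarianceBilin P v v := by
  rw [← posDef_covMatrix_iff]
  refine ⟨fun h => ?_, fun h => h.det_pos⟩
  rw [(posSemidef_covMatrix P).posDef_iff_isUnit, Matrix.isUnit_iff_isUnit_det]
  exact h.ne'.isUnit

lemma eq_multivariateGaussian [IsGaussian P] :
    P = multivariateGaussian (∫ x, x ∂P) (covMatrix P) := by
  refine eq_of_covarianceBilin_self integral_id_multivariateGaussian.symm fun t => ?_
  rw [covarianceBilin_multivariateGaussian (posSemidef_covMatrix P), dotProduct_covMatrix_mulVec]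

lemma integrable_inner_sub_sq [IsGaussian Q] (k : Vec d) (c : ℝ) :
    Integrable (fun x => (inner ℝ k x - c) ^ 2) Q :=
  ((IsGaussian.memLp_dual Q (innerSL ℝ k) 2 (by simp)).sub (memLp_const c)).integrable_sq

lemma integral_inner_sub_sq [IsGaussian Q] (k : Vec d) (c : ℝ) :
    ∫ x, (inner ℝ k x - c) ^ 2 ∂Q =
      covarianceBilin Q k k + (inner ℝ k (∫ x, x ∂Q) - c) ^ 2 := by
  have hL : MemLp (fun x => inner ℝ k x) 2 Q := IsGaussian.memLp_dual Q (innerSL ℝ k) 2 (by simp)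
  have h1 : Var[fun x => inner ℝ k x - c; Q] = covarianceBilin Q k k := by
    rw [variance_sub_const hL.1, covarianceBilin_self IsGaussian.memLp_two_id]
  have h2 : ∫ x, (inner ℝ k x - c) ∂Q = inner ℝ k (∫ x, x ∂Q) - c := by
    rw [integral_sub (hL.integrable (by simp)) (integrable_const c)]
    have := IsGaussian.integral_dual (μ := Q) (innerSL ℝ k)
    simp only [innerSL_apply_apply] at this
    simp [this]
  have hLc : MemLp (fun x => inner ℝ k x - c) 2 Q := hL.sub (memLp_const c)
  rw [variance_eq_sub hLc, h2] at h1
  simp only [Pi.pow_apply] at h1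
  linarith

/-- Splitting the quadratic form into squares of linear forms reduces its expectation to
one-dimensional variances and means. -/
lemma norm_sq_eq_sum_inner (K : Vec d →L[ℝ] Vec d) (m x : Vec d) :
    ‖K (x - m)‖ ^ 2 = ∑ i, (inner ℝ (K.adjoint (EuclideanSpace.single i 1)) x -
      inner ℝ (K.adjoint (EuclideanSpace.single i 1)) m) ^ 2 := by
  rw [EuclideanSpace.norm_sq_eq]
  refine Finset.sum_congr rfl fun i _ => ?_
  rw [← inner_sub_right, ContinuousLinearMap.adjoint_inner_left, EuclideanSpace.inner_single_left]
  simp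

lemma integrable_norm_sq [IsGaussian Q] (K : Vec d →L[ℝ] Vec d) (m : Vec d) :
    Integrable (fun x => ‖K (x - m)‖ ^ 2) Q := by
  simp_rw [norm_sq_eq_sum_inner]
  exact integrable_finsetSum _ fun i _ => integrable_inner_sub_sq _ _

lemma integral_norm_sq [IsGaussian Q] (K : Vec d →L[ℝ] Vec d) (m : Vec d) :
    ∫ x, ‖K (x - m)‖ ^ 2 ∂Q =
      ∑ i, (covarianceBilin Q (K.adjoint (EuclideanSpace.single i 1))
          (K.adjoint (EuclideanSpace.single i 1)) +
        (inner ℝ (K.adjoint (EuclideanSpace.single i 1)) (∫ x, x ∂Q) -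
          inner ℝ (K.adjoint (EuclideanSpace.single i 1)) m) ^ 2) := by
  simp_rw [norm_sq_eq_sum_inner]
  rw [integral_finsetSum _ fun i _ => integrable_inner_sub_sq _ _]
  simp_rw [integral_inner_sub_sq]

lemma integral_norm_sq_stdGaussian : ∫ x, ‖x‖ ^ 2 ∂(stdGaussian (Vec d)) = d := by
  have h := integral_norm_sq (Q := stdGaussian (Vec d)) (ContinuousLinearMap.id ℝ _) 0
  have hid : (ContinuousLinearMap.id ℝ (Vec d)).adjoint = ContinuousLinearMap.id ℝ _ :=
    ContinuousLinearMap.adjoint_id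
  rw [hid] at h
  simpa [covarianceBilin_stdGaussian, integral_id_stdGaussian, innerSL_apply_apply ℝ] using h

open scoped MatrixOrder Matrix.Norms.L2Operator in
/-- The density of a nondegenerate Gaussian law. -/
lemma exists_density [IsGaussian P] (hP : ∀ v, v ≠ 0 → 0 < covarianceBilin P v v) :
    ∃ K : Vec d →L[ℝ] Vec d,
      P = volume.withDensity (fun x => ENNReal.ofReal
        (gaussianConst d / Real.sqrt (covMatrix P).det *
          Real.exp (-(1 / 2) * ‖K (x - ∫ x, x ∂P)‖ ^ 2))) ∧
      ∫ x, ‖K (x - ∫ x, x ∂P)‖ ^ 2 ∂P = d := by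
  have hdet := (det_covMatrix_pos_iff P).2 hP
  set m := ∫ x, x ∂P with hm
  set R := CFC.sqrt (covMatrix P) with hR
  have hRR : R * R = covMatrix P := by
    exact CFC.sqrt_mul_sqrt_self _ (posSemidef_covMatrix P).nonneg
  have hRdet : R.det ^ 2 = (covMatrix P).det := by rw [← hRR, Matrix.det_mul, sq]
  have hRne : R.det ≠ 0 := fun h => by rw [h] at hRdet; simp at hRdet; linarith
  have hKR : R⁻¹ * R = 1 := Matrix.nonsing_inv_mul _ hRne.isUnit
  -- With `R` the square root of the covariance matrix, `P` is an affine image of the standard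
  -- Gaussian. Its density is a change of variables, with `R⁻¹` as the witness `K`.
  have hPmap : P = (stdGaussian (Vec d)).map (fun x => m + toCLM R x) := by
    conv_lhs => rw [eq_multivariateGaussian (P := P)]
    rfl
  have hinv : ∀ x, toCLM R⁻¹ (m + toCLM R x - m) = x := fun x => by
    rw [add_sub_cancel_left, ← toCLM_apply, ← toCLM_apply]
    simp [toLpLin_apply, hKR]
  refine ⟨toCLM R⁻¹, ?_, ?_⟩
  · have hvol : (volume : Measure (Vec d)).map (fun x => m + toCLM R x) =
        ENNReal.ofReal (Real.sqrt (covMatrix P).det)⁻¹ • volume := by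
      have hdetR : LinearMap.det (toEuclideanLin R) = R.det := by
        rw [toEuclideanLin, toLpLin_eq_toLin, LinearMap.det_toLin]
      have h1 := Measure.map_linearMap_addHaar_eq_smul_addHaar (volume : Measure (Vec d))
        (f := toEuclideanLin R) (by rwa [hdetR])
      have hmeas : Measurable (toEuclideanLin R) := (toCLM R).continuous.measurable
      have h2 : (fun x => m + toCLM R x) = (fun x => m + x) ∘ (toEuclideanLin R) := rfl
      rw [h2, ← Measure.map_map (by fun_prop) hmeas, h1, hdetR,
        Measure.map_smul, map_add_left_eq_self, ← hRdet, Real.sqrt_sq_eq_abs, abs_inv]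
    refine hPmap.trans ?_
    have h3 : (fun v : Vec d => ENNReal.ofReal
        (gaussianConst d * Real.exp (-(1 / 2) * ‖v‖ ^ 2))) =
        (fun y => ENNReal.ofReal (gaussianConst d *
          Real.exp (-(1 / 2) * ‖toCLM R⁻¹ (y - m)‖ ^ 2))) ∘ (fun x => m + toCLM R x) := by
      ext v
      simp only [Function.comp_apply, hinv]
    rw [stdGaussian_eq_withDensity, h3, map_withDensity_comp _ (by fun_prop) (by fun_prop), hvol,
      withDensity_smul_measure, ← withDensity_smul _ (by fun_prop)]
    congr 1
    ext y
    rw [Pi.smul_apply, smul_eq_mul, ← ENNReal.ofReal_mul (by positivity)]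
    congr 1
    ring
  · conv_lhs => rw [hPmap]
    rw [integral_map (by fun_prop) (by fun_prop)]
    simp_rw [hinv]
    exact integral_norm_sq_stdGaussian

end Density

end MicroMacro

namespace MicroMacro

open InformationTheory

/-! ### The Kullback–Leibler divergence between Gaussian laws -/

section KL

/-- The log-likelihood ratio of the two densities is explicit, and is integrated term by term. -/
lemma klDiv_withDensity_exp {α : Type*} {mα : MeasurableSpace α} {μ P Q : Measure α}
    [SigmaFinite μ] [IsProbabilityMeasure P] [IsProbabilityMeasure Q] {a b : ℝ} {φ ψ : α → ℝ}
    (ha : 0 < a) (hb : 0 < b) (hφ : Measurable φ) (hψ : Measurable ψ)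
    (hP : P = μ.withDensity (fun x => ENNReal.ofReal (a * Real.exp (-(1 / 2) * φ x))))
    (hQ : Q = μ.withDensity (fun x => ENNReal.ofReal (b * Real.exp (-(1 / 2) * ψ x))))
    (hφi : Integrable φ P) (hψi : Integrable ψ P) :
    klDiv P Q = ENNReal.ofReal
      (Real.log a - Real.log b - (1 / 2) * ∫ x, φ x ∂P + (1 / 2) * ∫ x, ψ x ∂P) := by
  set g : α → ℝ := fun x => a * Real.exp (-(1 / 2) * φ x) / (b * Real.exp (-(1 / 2) * ψ x)) with hg
  have hgm : Measurable (fun x => ENNReal.ofReal (g x)) := by fun_prop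
  have hPQ : P = Q.withDensity (fun x => ENNReal.ofReal (g x)) := by
    rw [hQ, ← withDensity_mul _ (by fun_prop) hgm, hP]
    congr 1
    ext x
    rw [Pi.mul_apply, ← ENNReal.ofReal_mul (by positivity), hg]
    congr 1
    field_simp
  have hac : P ≪ Q := by
    rw [hPQ]
    exact withDensity_absolutelyContinuous _ _
  have hllr : llr P Q =ᵐ[P] fun x =>
      Real.log a - Real.log b - (1 / 2) * φ x + (1 / 2) * ψ x := by
    have h1 : P.rnDeriv Q =ᵐ[Q] fun x => ENNReal.ofReal (g x) := by
      conv_lhs => rw [hPQ]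
      exact Measure.rnDeriv_withDensity _ hgm
    filter_upwards [hac.ae_le h1] with x hx
    rw [llr, hx, ENNReal.toReal_ofReal (by positivity), hg, Real.log_div (by positivity)
      (by positivity), Real.log_mul ha.ne' (by positivity), Real.log_mul hb.ne' (by positivity),
      Real.log_exp, Real.log_exp]
    ring
  have hi1 : Integrable (fun x => Real.log a - Real.log b - (1 / 2) * φ x) P :=
    (integrable_const _).sub (hφi.const_mul _)
  have hi : Integrable (llr P Q) P := (hi1.add (hψi.const_mul (1 / 2))).congr hllr.symm
  rw [klDiv_of_ac_of_integrable hac hi, integral_congr_ae hllr,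
    integral_add hi1 (hψi.const_mul _), integral_sub (integrable_const _) (hφi.const_mul _),
    integral_const_mul, integral_const_mul]
  simp

variable {d : ℕ} {P Q : Measure (Vec d)}

/-- The divergence between nondegenerate Gaussian laws; `K` depends on the second one only. -/
lemma exists_klDiv_eq [IsGaussian Q] (hQ : ∀ v, v ≠ 0 → 0 < covarianceBilin Q v v) :
    ∃ K : Vec d →L[ℝ] Vec d, ∀ P : Measure (Vec d), IsGaussian P →
      (∀ v, v ≠ 0 → 0 < covarianceBilin P v v) → klDiv P Q = ENNReal.ofReal
        ((1 / 2) * (Real.log (covMatrix Q).det - Real.log (covMatrix P).det) - (1 / 2) * d +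
          (1 / 2) * ∑ i, (covarianceBilin P (K.adjoint (EuclideanSpace.single i 1))
            (K.adjoint (EuclideanSpace.single i 1)) +
          (inner ℝ (K.adjoint (EuclideanSpace.single i 1)) (∫ x, x ∂P) -
            inner ℝ (K.adjoint (EuclideanSpace.single i 1)) (∫ x, x ∂Q)) ^ 2)) := by
  obtain ⟨K, hK, -⟩ := exists_density hQ
  refine ⟨K, fun P _ hP => ?_⟩
  obtain ⟨K', hK', hK'd⟩ := exists_density hP
  have h1 := (det_covMatrix_pos_iff P).2 hP
  have h2 := (det_covMatrix_pos_iff Q).2 hQ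
  have hc := gaussianConst_pos d
  -- The quadratic form in the density of `P` has expectation `d`, so `K'` drops out and only the
  -- fixed `K` remains.
  rw [klDiv_withDensity_exp (by positivity) (by positivity) (by fun_prop) (by fun_prop) hK' hK
    (integrable_norm_sq K' _) (integrable_norm_sq K _), hK'd, integral_norm_sq,
    Real.log_div hc.ne' (by positivity), Real.log_div hc.ne' (by positivity), Real.log_sqrt h1.le,
    Real.log_sqrt h2.le]
  congr 1
  ring

/-- Convergence of the means and of the covariances of a family of laws. -/
structure MomentsTendsto {ι : Type*} (P : ι → Measure (Vec d)) (l : Filter ι)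
    (Q : Measure (Vec d)) : Prop where
  isGaussian : ∀ᶠ i in l, IsGaussian (P i)
  mean : Tendsto (fun i => ∫ x, x ∂(P i)) l (𝓝 (∫ x, x ∂Q))
  cov : ∀ t, Tendsto (fun i => covarianceBilin (P i) t t) l (𝓝 (covarianceBilin Q t t))

lemma MomentsTendsto.det_covMatrix {ι : Type*} {P : ι → Measure (Vec d)} {l : Filter ι}
    (h : MomentsTendsto P l Q) :
    Tendsto (fun i => (covMatrix (P i)).det) l (𝓝 (covMatrix Q).det) := by
  have hM : Tendsto (fun i => covMatrix (P i)) l (𝓝 (covMatrix Q)) := by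
    refine tendsto_pi_nhds.2 fun i => tendsto_pi_nhds.2 fun j => ?_
    simp only [covMatrix, of_apply]
    simp_rw [covarianceBilin_eq_quarter _ (EuclideanSpace.single i (1 : ℝ))]
    exact ((h.cov _).sub (h.cov _)).div_const 4
  exact ((continuous_id.matrix_det).tendsto _).comp hM

lemma MomentsTendsto.eventually_nondegenerate {ι : Type*} {P : ι → Measure (Vec d)}
    {l : Filter ι} (h : MomentsTendsto P l Q) (hQ : ∀ v, v ≠ 0 → 0 < covarianceBilin Q v v) :
    ∀ᶠ i in l, ∀ v, v ≠ 0 → 0 < covarianceBilin (P i) v v := by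
  filter_upwards [h.det_covMatrix.eventually_const_lt ((det_covMatrix_pos_iff Q).2 hQ)] with i hi
  exact (det_covMatrix_pos_iff _).1 hi

/-- The divergence from a nondegenerate Gaussian law is a continuous function of the mean and
covariance of nondegenerate Gaussian laws. -/
lemma MomentsTendsto.tendsto_klDiv {ι : Type*} {P : ι → Measure (Vec d)} {l : Filter ι}
    {R : Measure (Vec d)} [IsGaussian Q] [IsGaussian R] (h : MomentsTendsto P l Q)
    (hQ : ∀ v, v ≠ 0 → 0 < covarianceBilin Q v v) (hR : ∀ v, v ≠ 0 → 0 < covarianceBilin R v v) :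
    Tendsto (fun i => klDiv (P i) R) l (𝓝 (klDiv Q R)) := by
  obtain ⟨K, hK⟩ := exists_klDiv_eq hR
  rw [hK Q inferInstance hQ]
  have hev := (h.isGaussian.and (h.eventually_nondegenerate hQ)).mono fun i hi =>
    (hK (P i) hi.1 hi.2).symm
  refine Tendsto.congr' hev (ENNReal.tendsto_ofReal ?_)
  have hdet := h.det_covMatrix.log ((det_covMatrix_pos_iff Q).2 hQ).ne'
  refine (((tendsto_const_nhds.sub hdet).const_mul _).sub_const _).add
    (Tendsto.const_mul _ (tendsto_finsetSum _ fun i _ => (h.cov _).add ?_))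
  exact ((tendsto_const_nhds.inner h.mean).sub_const _).pow 2

end KL

/-! ### Total variation -/

section TotalVariation

/-- The bound `log √x ≥ 1 - 1 / √x` gives `(√x - 1)² ≤ klFun x`. Then `|x - 1| = |√x - 1| (√x + 1)`
is split by the weighted arithmetic–geometric mean inequality, with `(√x + 1)² ≤ 2 (x + 1)`. -/
lemma abs_sub_one_le_of_klFun {x ε : ℝ} (hx : 0 ≤ x) (hε : 0 < ε) :
    |x - 1| ≤ klFun x / (2 * ε) + ε * (x + 1) := by
  have hs := Real.sqrt_nonneg x
  have hsq := Real.sq_sqrt hx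
  have h1 : (Real.sqrt x - 1) ^ 2 ≤ klFun x := by
    rcases hx.eq_or_lt with rfl | hpos
    · simp [klFun]
    · have hs' : 0 < Real.sqrt x := Real.sqrt_pos.2 hpos
      have h2 := Real.one_sub_inv_le_log_of_pos hs'
      rw [Real.log_sqrt hx] at h2
      have h3 : x * (1 - (Real.sqrt x)⁻¹) = x - Real.sqrt x := by
        have : x * (Real.sqrt x)⁻¹ = Real.sqrt x := by
          rw [← div_eq_mul_inv, Real.div_sqrt]
        rw [mul_sub, this, mul_one]
      have h4 := mul_le_mul_of_nonneg_left h2 hx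
      rw [h3] at h4
      rw [klFun_apply]
      nlinarith
  have h2 : |x - 1| = |Real.sqrt x - 1| * (Real.sqrt x + 1) := by
    rw [← abs_of_nonneg (by positivity : 0 ≤ Real.sqrt x + 1), ← abs_mul]
    congr 1
    nlinarith
  rw [h2]
  have h3 : |Real.sqrt x - 1| * (Real.sqrt x + 1) ≤
      (Real.sqrt x - 1) ^ 2 / (2 * ε) + ε / 2 * (Real.sqrt x + 1) ^ 2 := by
    rw [← sq_abs (Real.sqrt x - 1)]
    set a := |Real.sqrt x - 1|
    set b := Real.sqrt x + 1
    have : a ^ 2 / (2 * ε) + ε / 2 * b ^ 2 - a * b = (a - ε * b) ^ 2 / (2 * ε) := by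
      field_simp
      ring
    have h0 : 0 ≤ (a - ε * b) ^ 2 / (2 * ε) := by positivity
    linarith
  have h4 : (Real.sqrt x - 1) ^ 2 / (2 * ε) ≤ klFun x / (2 * ε) := by gcongr
  have h5 : ε / 2 * (Real.sqrt x + 1) ^ 2 ≤ ε * (x + 1) := by nlinarith [sq_nonneg (Real.sqrt x - 1)]
  linarith

/-- A weak Pinsker inequality: the pointwise bound is applied to the density of `P` and integrated
against `Q`. The parameter `ε` stays free. -/
lemma abs_measureReal_sub_le {α : Type*} {mα : MeasurableSpace α} {P Q : Measure α}
    [IsProbabilityMeasure P] [IsProbabilityMeasure Q] (h : klDiv P Q ≠ ∞) (s : Set α)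
    {ε : ℝ} (hε : 0 < ε) :
    |P.real s - Q.real s| ≤ (klDiv P Q).toReal / (2 * ε) + 2 * ε := by
  obtain ⟨hac, hint⟩ := klDiv_ne_top_iff.1 h
  set f : α → ℝ := fun x => (P.rnDeriv Q x).toReal with hf
  have hfi : Integrable f Q := Measure.integrable_toReal_rnDeriv
  have hki : Integrable (fun x => klFun (f x)) Q := (integrable_klFun_rnDeriv_iff hac).2 hint
  have hf1 : ∫ x, f x ∂Q = 1 := by
    rw [Measure.integral_toReal_rnDeriv hac]
    simp
  have h1 : P.real s - Q.real s = ∫ x in s, (f x - 1) ∂Q := by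
    rw [integral_sub hfi.integrableOn (integrable_const _), Measure.setIntegral_toReal_rnDeriv hac]
    simp
  have hfi1 : Integrable (fun x => f x + 1) Q := hfi.add (integrable_const _)
  have hbi : Integrable (fun x => klFun (f x) / (2 * ε) + ε * (f x + 1)) Q :=
    (hki.div_const _).add (hfi1.const_mul _)
  have hai : Integrable (fun x => |f x - 1|) Q := (hfi.sub (integrable_const _)).abs
  calc |P.real s - Q.real s| = |∫ x in s, (f x - 1) ∂Q| := by rw [h1]
    _ ≤ ∫ x in s, |f x - 1| ∂Q := abs_integral_le_integral_abs
    _ ≤ ∫ x, |f x - 1| ∂Q := setIntegral_le_integral hai (ae_of_all _ fun _ => abs_nonneg _)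
    _ ≤ ∫ x, (klFun (f x) / (2 * ε) + ε * (f x + 1)) ∂Q :=
        integral_mono hai hbi fun x => abs_sub_one_le_of_klFun ENNReal.toReal_nonneg hε
    _ = (klDiv P Q).toReal / (2 * ε) + 2 * ε := by
        rw [integral_add (hki.div_const _) (hfi1.const_mul _),
          integral_div, integral_const_mul, integral_add hfi (integrable_const _), hf1,
          toReal_klDiv_eq_integral_klFun hac]
        simp
        ring

variable {k : ℕ} {P Q R : Measure (Vec k)}

lemma bddAbove_tvDist [IsProbabilityMeasure P] [IsProbabilityMeasure Q] :
    BddAbove (Set.range fun s : {s : Set (Vec k) // MeasurableSet s} =>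
      |P.real s.1 - Q.real s.1|) := by
  refine ⟨1, ?_⟩
  rintro _ ⟨s, rfl⟩
  have h1 := measureReal_nonneg (μ := P) (s := s.1)
  have h2 := measureReal_nonneg (μ := Q) (s := s.1)
  have h3 := measureReal_le_one (μ := P) (s := s.1)
  have h4 := measureReal_le_one (μ := Q) (s := s.1)
  exact abs_le.2 ⟨by linarith, by linarith⟩

lemma tvDist_nonneg (P Q : Measure (Vec k)) : 0 ≤ tvDist P Q :=
  Real.iSup_nonneg fun _ => abs_nonneg _

lemma le_tvDist [IsProbabilityMeasure P] [IsProbabilityMeasure Q] {s : Set (Vec k)}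
    (hs : MeasurableSet s) : |P.real s - Q.real s| ≤ tvDist P Q :=
  le_ciSup (f := fun s : {s : Set (Vec k) // MeasurableSet s} => |P.real s.1 - Q.real s.1|)
    bddAbove_tvDist ⟨s, hs⟩

lemma tvDist_le {c : ℝ} (h : ∀ s, MeasurableSet s → |P.real s - Q.real s| ≤ c) :
    tvDist P Q ≤ c := by
  have : Nonempty {s : Set (Vec k) // MeasurableSet s} := ⟨⟨∅, MeasurableSet.empty⟩⟩
  exact ciSup_le fun s => h s.1 s.2

lemma tvDist_comm (P Q : Measure (Vec k)) : tvDist P Q = tvDist Q P := by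
  simp only [tvDist, abs_sub_comm]

lemma tvDist_triangle [IsProbabilityMeasure P] [IsProbabilityMeasure Q] [IsProbabilityMeasure R] :
    tvDist P R ≤ tvDist P Q + tvDist Q R :=
  tvDist_le fun _ hs => (abs_sub_le _ _ _).trans (add_le_add (le_tvDist hs) (le_tvDist hs))

lemma abs_tvDist_sub_tvDist_le [IsProbabilityMeasure P] [IsProbabilityMeasure Q]
    [IsProbabilityMeasure R] : |tvDist P R - tvDist Q R| ≤ tvDist P Q := by
  have h1 := tvDist_triangle (P := P) (Q := Q) (R := R)
  have h2 := tvDist_triangle (P := Q) (Q := P) (R := R)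
  rw [tvDist_comm Q P] at h2
  exact abs_sub_le_iff.2 ⟨by linarith, by linarith⟩

/-- Convergence in divergence implies convergence in total variation. -/
lemma tendsto_tvDist_of_klDiv {ι : Type*} {P : ι → Measure (Vec k)} {l : Filter ι}
    [IsProbabilityMeasure Q] (hP : ∀ᶠ i in l, IsProbabilityMeasure (P i))
    (h : Tendsto (fun i => klDiv (P i) Q) l (𝓝 0)) :
    Tendsto (fun i => tvDist (P i) Q) l (𝓝 0) := by
  refine tendsto_order.2 ⟨fun a ha => ?_, fun a ha => ?_⟩
  · exact Eventually.of_forall fun i => ha.trans_le (tvDist_nonneg _ _)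
  -- With `ε = a / 4` and divergence below `a² / 8`, the bound is less than `a / 4 + a / 2`.
  · have hε : 0 < a / 4 := by positivity
    have hlt : (0 : ℝ≥0∞) < ENNReal.ofReal (a ^ 2 / 8) := by
      rw [ENNReal.ofReal_pos]; positivity
    filter_upwards [hP, h.eventually_lt_const hlt] with i hi1 hi2
    have hfin : klDiv (P i) Q ≠ ∞ := hi2.ne_top
    have hkl : (klDiv (P i) Q).toReal < a ^ 2 / 8 := by
      rwa [ENNReal.lt_ofReal_iff_toReal_lt hfin] at hi2
    refine (tvDist_le fun s _ => abs_measureReal_sub_le hfin s hε).trans_lt ?_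
    have : (klDiv (P i) Q).toReal / (2 * (a / 4)) < a ^ 2 / 8 / (2 * (a / 4)) := by gcongr
    have h3 : a ^ 2 / 8 / (2 * (a / 4)) = a / 4 := by
      field_simp
      norm_num
    linarith

end TotalVariation

end MicroMacro

namespace MicroMacro

/-! ### The Euler scheme along a path -/

section EulerPath

/-- The number of steps of size slightly larger than `δ` that fit into `[0, T]`. -/
noncomputable def numSteps (T δ : ℝ) : ℕ := ⌈T / δ⌉₊ - 1

lemma numSteps_mul_lt {T δ : ℝ} (hT : 0 < T) (hδ : 0 < δ) : numSteps T δ * δ < T := by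
  have h1 : (numSteps T δ : ℝ) < T / δ := by
    rw [← Nat.lt_ceil, numSteps]
    exact Nat.sub_lt (Nat.ceil_pos.2 (div_pos hT hδ)) one_pos
  rwa [lt_div_iff₀ hδ] at h1

lemma le_numSteps_add_one_mul {T δ : ℝ} (hδ : 0 < δ) : T ≤ (numSteps T δ + 1) * δ := by
  have h1 : T / δ ≤ (numSteps T δ : ℝ) + 1 := by
    refine (Nat.le_ceil _).trans ?_
    rw [numSteps]
    exact_mod_cast le_tsub_add
  rwa [div_le_iff₀ hδ] at h1

/-- For steps slightly larger than `δ`, the number of steps up to time `T` is `numSteps T δ`. -/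
lemma eventually_floor_eq_numSteps {T δ : ℝ} (hT : 0 < T) (hδ : 0 < δ) :
    ∀ᶠ Δ in 𝓝[>] δ, ⌊T / Δ⌋₊ = numSteps T δ := by
  have hcont : Tendsto (fun Δ : ℝ => numSteps T δ * Δ) (𝓝[>] δ) (𝓝 (numSteps T δ * δ)) :=
    ((continuous_const.mul continuous_id).tendsto δ).mono_left nhdsWithin_le_nhds
  filter_upwards [hcont.eventually_lt_const (numSteps_mul_lt hT hδ), self_mem_nhdsWithin]
    with Δ h1 h2
  have hΔ : 0 < Δ := hδ.trans h2
  -- The strict bound `numSteps T δ * δ < T` survives a slight increase of `δ`, while `T ≤ (numSteps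
  -- T δ + 1) * δ` becomes strict since `Δ > δ`. If `T / δ` is an integer, the count is thus `T / δ
  -- - 1`.
  rw [Nat.floor_eq_iff (div_pos hT hΔ).le, le_div_iff₀ hΔ, div_lt_iff₀ hΔ]
  refine ⟨h1.le, (le_numSteps_add_one_mul hδ).trans_lt ?_⟩
  exact mul_lt_mul_of_pos_left h2 (by positivity)

lemma tendsto_numSteps_mul {T : ℝ} (hT : 0 < T) :
    Tendsto (fun δ => numSteps T δ * δ) (𝓝[>] 0) (𝓝 T) := by
  have h1 : Tendsto (fun δ : ℝ => T - δ) (𝓝[>] 0) (𝓝 T) := by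
    have : Tendsto (fun δ : ℝ => T - δ) (𝓝 0) (𝓝 (T - 0)) :=
      (continuous_const.sub continuous_id).tendsto 0
    rw [sub_zero] at this
    exact this.mono_left nhdsWithin_le_nhds
  refine tendsto_of_tendsto_of_tendsto_of_le_of_le' h1 tendsto_const_nhds ?_ ?_
  · filter_upwards [self_mem_nhdsWithin] with δ hδ
    have := le_numSteps_add_one_mul (T := T) hδ
    linarith
  · filter_upwards [self_mem_nhdsWithin] with δ hδ
    exact (numSteps_mul_lt hT hδ).le

variable {d : ℕ} (A : Matrix (Fin d) (Fin d) ℝ)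

/-- The Euler scheme for `dx = A x dt + dG`, where `g k` is the value of `G` after `k` steps. -/
noncomputable def eulerPath (δ : ℝ) (x₀ : Vec d) (g : ℕ → Vec d) : ℕ → Vec d
  | 0 => x₀
  | k + 1 => stepCLM A δ (eulerPath δ x₀ g k) + (g (k + 1) - g k)

variable {A} {u G : ℝ → Vec d} {T : ℝ}

/-- Discrete Gronwall: the error obeys `e (k + 1) ≤ (1 + δ ‖A‖) e k + δ ‖A‖ ε`. The increments of
`G` cancel exactly, so only the oscillation of `u` matters and no regularity of `G` enters. -/
lemma norm_sub_eulerPath_le {δ ε : ℝ} (hδ : 0 < δ) (hu : Continuous u)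
    (heq : ∀ s t, 0 ≤ s → s ≤ t → u t - u s = (∫ r in s..t, toCLM A (u r)) + (G t - G s))
    (hosc : ∀ s t, 0 ≤ s → s ≤ t → t ≤ T → t - s ≤ δ → ‖u t - u s‖ ≤ ε) (k : ℕ)
    (hk : k * δ ≤ T) :
    ‖u (k * δ) - eulerPath A δ (u 0) (fun k => G (k * δ)) k‖ ≤
      ((1 + δ * ‖toCLM A‖) ^ k - 1) * ε := by
  induction k with
  | zero => simp [eulerPath]
  | succ k ih =>
    push_cast at hk ⊢
    have hkk : (k : ℝ) * δ ≤ (k + 1) * δ := by nlinarith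
    have ih' := ih (hkk.trans hk)
    set y := eulerPath A δ (u 0) (fun k => G (k * δ)) k with hy
    have hk0 : (0 : ℝ) ≤ k * δ := by positivity
    have hstep := heq (k * δ) ((k + 1) * δ) hk0 hkk
    have hAu : Continuous fun r => toCLM A (u r) := (toCLM A).continuous.comp hu
    have hint : (∫ r in (k * δ)..((k + 1) * δ), toCLM A (u r)) =
        (∫ r in (k * δ)..((k + 1) * δ), toCLM A (u r - u (k * δ))) +
          δ • toCLM A (u (k * δ)) := by
      simp only [map_sub]
      rw [intervalIntegral.integral_sub (hAu.intervalIntegrable _ _)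
        (continuous_const.intervalIntegrable _ _), intervalIntegral.integral_const]
      have : ((k : ℝ) + 1) * δ - k * δ = δ := by ring
      rw [this]
      abel
    have hbound : ‖∫ r in (k * δ)..((k + 1) * δ), toCLM A (u r - u (k * δ))‖ ≤
        ‖toCLM A‖ * ε * δ := by
      have h1 : ∀ r ∈ Set.uIoc ((k : ℝ) * δ) ((k + 1) * δ),
          ‖toCLM A (u r - u (k * δ))‖ ≤ ‖toCLM A‖ * ε := by
        intro r hr
        rw [Set.uIoc_of_le hkk] at hr
        refine ((toCLM A).le_opNorm _).trans ?_
        gcongr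
        exact hosc _ _ hk0 hr.1.le (hr.2.trans hk) (by nlinarith [hr.2])
      refine (intervalIntegral.norm_integral_le_of_norm_le_const h1).trans_eq ?_
      rw [show ((k : ℝ) + 1) * δ - k * δ = δ by ring, abs_of_pos hδ]
    have hdecomp : u ((k + 1) * δ) - eulerPath A δ (u 0) (fun k => G (k * δ)) (k + 1) =
        (u (k * δ) - y) + δ • toCLM A (u (k * δ) - y) +
          ∫ r in (k * δ)..((k + 1) * δ), toCLM A (u r - u (k * δ)) := by
      have h2 : u ((k + 1) * δ) = u (k * δ) +
          ((∫ r in (k * δ)..((k + 1) * δ), toCLM A (u r)) +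
            (G ((k + 1) * δ) - G (k * δ))) := by
        rw [← hstep]; abel
      rw [h2, hint, eulerPath, ← hy, stepCLM_apply, map_sub, smul_sub]
      push_cast
      abel
    rw [hdecomp]
    have h3 : ‖δ • toCLM A (u (k * δ) - y)‖ ≤ δ * ‖toCLM A‖ * ‖u (k * δ) - y‖ := by
      rw [norm_smul, Real.norm_of_nonneg hδ.le, mul_assoc]
      gcongr
      exact (toCLM A).le_opNorm _
    refine (norm_add_le _ _).trans ?_
    refine (add_le_add_left (norm_add_le _ _) _).trans ?_
    have h4 : (1 + δ * ‖toCLM A‖) * ‖u (k * δ) - y‖ ≤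
        (1 + δ * ‖toCLM A‖) * (((1 + δ * ‖toCLM A‖) ^ k - 1) * ε) := by gcongr
    rw [pow_succ]
    nlinarith

/-- The Euler scheme converges along every continuous path solving the integral equation. -/
lemma tendsto_eulerPath (hT : 0 < T) (hu : Continuous u)
    (heq : ∀ s t, 0 ≤ s → s ≤ t → u t - u s = (∫ r in s..t, toCLM A (u r)) + (G t - G s)) :
    Tendsto (fun δ => eulerPath A δ (u 0) (fun k => G (k * δ)) (numSteps T δ))
      (𝓝[>] 0) (𝓝 (u T)) := by
  have h1 : Tendsto (fun δ => u (numSteps T δ * δ)) (𝓝[>] 0) (𝓝 (u T)) :=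
    (hu.tendsto T).comp (tendsto_numSteps_mul hT)
  suffices h2 : Tendsto (fun δ => u (numSteps T δ * δ) -
      eulerPath A δ (u 0) (fun k => G (k * δ)) (numSteps T δ)) (𝓝[>] 0) (𝓝 0) by
    simpa using h1.sub h2
  rw [Metric.tendsto_nhds]
  intro ε hε
  set C := Real.exp (‖toCLM A‖ * T) with hC
  have hCpos : 0 < C := Real.exp_pos _
  have huc : UniformContinuousOn u (Set.Icc 0 T) :=
    isCompact_Icc.uniformContinuousOn_of_continuous hu.continuousOn
  rw [Metric.uniformContinuousOn_iff_le] at huc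
  -- The growth factor `(1 + δ ‖A‖) ^ numSteps T δ` is at most `C`, so oscillation `ε / C` keeps the
  -- error below `ε`.
  obtain ⟨η, hη, hmod⟩ := huc (ε / C) (by positivity)
  filter_upwards [self_mem_nhdsWithin, Ioo_mem_nhdsGT hη] with δ hδ hδη
  have hδ' : 0 < δ := hδ
  have hN := numSteps_mul_lt hT hδ'
  have hb := norm_sub_eulerPath_le (T := T) (ε := ε / C) hδ' hu heq (fun s t hs hst ht hts => by
    rw [← dist_eq_norm]
    refine hmod t ⟨hs.trans hst, ht⟩ s ⟨hs, hst.trans ht⟩ ?_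
    rw [Real.dist_eq, abs_of_nonneg (by linarith)]
    linarith [hδη.2]) (numSteps T δ) hN.le
  rw [dist_zero_right]
  refine hb.trans_lt ?_
  have h3 : (1 + δ * ‖toCLM A‖) ^ numSteps T δ ≤ C := by
    have h4 : 1 + δ * ‖toCLM A‖ ≤ Real.exp (δ * ‖toCLM A‖) := by
      linarith [Real.add_one_le_exp (δ * ‖toCLM A‖)]
    calc (1 + δ * ‖toCLM A‖) ^ numSteps T δ ≤ Real.exp (δ * ‖toCLM A‖) ^ numSteps T δ := by gcongr
      _ = Real.exp (numSteps T δ * δ * ‖toCLM A‖) := by rw [← Real.exp_nat_mul, mul_assoc]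
      _ ≤ C := by
        rw [hC, mul_comm ‖toCLM A‖]
        gcongr
  calc ((1 + δ * ‖toCLM A‖) ^ numSteps T δ - 1) * (ε / C) ≤ (C - 1) * (ε / C) := by gcongr
    _ < C * (ε / C) := by gcongr; linarith
    _ = ε := by field_simp

/-- The Euler scheme for `x' = A x` converges. -/
lemma exists_tendsto_eulerPath_zero (A : Matrix (Fin d) (Fin d) ℝ) (hT : 0 < T) (x₀ : Vec d) :
    ∃ x, Tendsto (fun δ => eulerPath A δ x₀ (fun _ => 0) (numSteps T δ)) (𝓝[>] 0) (𝓝 x) := by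
  set v : ℝ → Vec d := fun t => NormedSpace.exp (t • toCLM A) x₀ with hv
  have hderiv : ∀ t, HasDerivAt v (toCLM A (v t)) t := fun t =>
    (hasDerivAt_exp_smul_const' (𝕂 := ℝ) (toCLM A) t).clm_apply (hasDerivAt_const t x₀) |>.congr_deriv
      (by simp [hv])
  have hcont : Continuous v := continuous_iff_continuousAt.2 fun t => (hderiv t).continuousAt
  have h := tendsto_eulerPath (A := A) (u := v) (G := fun _ => 0) hT hcont (fun s t _ _ => by
    rw [sub_self, add_zero]
    exact (intervalIntegral.integral_eq_sub_of_hasDerivAt (fun r _ => hderiv r)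
      (((toCLM A).continuous.comp hcont).intervalIntegrable _ _)).symm)
  have h0 : v 0 = x₀ := by
    have h00 : (0 : ℝ) • toCLM A = 0 := by
      ext1 x
      exact zero_smul ℝ (toCLM A x)
    have h1 : v 0 = NormedSpace.exp ((0 : ℝ) • toCLM A) x₀ := rfl
    rw [h1, h00, NormedSpace.exp_zero]
    rfl
  rw [h0] at h
  exact ⟨_, h⟩

end EulerPath

/-! ### Limits of Gaussian laws -/

section GaussianLimit

variable {d : ℕ} {ι : Type*} {P : ι → Measure (Vec d)} {l : Filter ι} {Q : Measure (Vec d)}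

lemma norm_charFun_of_isGaussian {P : Measure (Vec d)} [IsGaussian P] (t : Vec d) :
    ‖charFun P t‖ = Real.exp (-(covarianceBilin P t t / 2)) := by
  rw [IsGaussian.charFun_eq', Complex.norm_exp]
  congr 1
  simp [Complex.sub_re]

/-- A limit of Gaussian laws with convergent means, in the sense of characteristic functions, is
Gaussian, and the means and covariances converge. -/
lemma momentsTendsto_of_charFun [l.NeBot] [IsProbabilityMeasure Q] {m : Vec d}
    (hP : ∀ᶠ i in l, IsGaussian (P i)) (hm : Tendsto (fun i => ∫ x, x ∂(P i)) l (𝓝 m))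
    (hchar : ∀ t, Tendsto (fun i => charFun (P i) t) l (𝓝 (charFun Q t))) :
    IsGaussian Q ∧ MomentsTendsto P l Q := by
  have hc : ∀ t, ∃ c, Tendsto (fun i => covarianceBilin (P i) t t) l (𝓝 c) := by
    intro t
    -- The variance is read off from `log ‖charFun‖`, which needs a nonzero limit. Continuity at `0`
    -- provides this at a small multiple `s • t`, and homogeneity divides out `s²`.
    have hcont : Tendsto (fun s : ℝ => charFun Q (s • t)) (𝓝[>] 0) (𝓝 1) := by
      have h1 : Continuous fun s : ℝ => charFun Q (s • t) :=
        continuous_charFun.comp (continuous_id.smul continuous_const)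
      have h2 := h1.tendsto 0
      simp only [zero_smul, charFun_zero, probReal_univ, Complex.ofReal_one] at h2
      exact h2.mono_left nhdsWithin_le_nhds
    obtain ⟨s, hs1, hs2⟩ := ((hcont.eventually_ne one_ne_zero).and self_mem_nhdsWithin).exists
    have hs : (0 : ℝ) < s := hs2
    have h1 := ((hchar (s • t)).norm.log (norm_ne_zero_iff.2 hs1)).const_mul (-2 / s ^ 2)
    refine ⟨_, Tendsto.congr' ?_ h1⟩
    filter_upwards [hP] with i hi
    rw [norm_charFun_of_isGaussian, Real.log_exp]
    simp only [map_smul, _root_.smul_apply, smul_eq_mul]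
    field_simp
  choose c hc using hc
  have hQ : ∀ t, charFun Q t = Complex.exp ((inner ℝ t m : ℝ) * Complex.I - (c t : ℝ) / 2) := by
    intro t
    refine tendsto_nhds_unique (hchar t) ?_
    have h1 : Tendsto (fun i => Complex.exp ((inner ℝ t (∫ x, x ∂(P i)) : ℝ) * Complex.I -
        (covarianceBilin (P i) t t : ℝ) / 2)) l
        (𝓝 (Complex.exp ((inner ℝ t m : ℝ) * Complex.I - (c t : ℝ) / 2))) := by
      refine (Complex.continuous_exp.tendsto _).comp (Tendsto.sub ?_ ?_)
      · exact ((Complex.continuous_ofReal.tendsto _).comp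
          (tendsto_const_nhds.inner hm)).mul_const _
      · exact ((Complex.continuous_ofReal.tendsto _).comp (hc t)).div_const _
    refine Tendsto.congr' ?_ h1
    filter_upwards [hP] with i hi
    rw [IsGaussian.charFun_eq']
    simp
  have hc0 : ∀ t, 0 ≤ c t := fun t =>
    ge_of_tendsto' (hc t) fun i => covarianceBilin_self_nonneg _
  have hcs : ∀ (s : ℝ) t, c (s • t) = s ^ 2 * c t := by
    intro s t
    refine tendsto_nhds_unique (hc (s • t)) (((hc t).const_mul (s ^ 2)).congr fun i => ?_)
    simp only [map_smul, _root_.smul_apply, smul_eq_mul]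
    ring
  have hmap : ∀ t, Q.map (fun x => inner ℝ t x) = gaussianReal (inner ℝ t m) (c t).toNNReal := by
    intro t
    apply Measure.ext_of_charFun
    ext s
    have h1 : charFun (Q.map (fun x => inner ℝ t x)) s = charFun Q (s • t) := by
      rw [charFun_apply, charFun_apply, integral_map (by fun_prop) (by fun_prop)]
      congr 1
      ext x
      simp [inner_smul_right, real_inner_comm x t, mul_comm]
    rw [h1, hQ, charFun_gaussianReal, hcs, inner_smul_left, Real.coe_toNNReal _ (hc0 t)]
    congr 1
    push_cast
    simp only [conj_trivial]
    ring
  have hG : IsGaussian Q := by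
    refine isGaussian_of_map_eq_gaussianReal fun L => ?_
    obtain ⟨t, rfl⟩ := (InnerProductSpace.toDual ℝ (Vec d)).surjective L
    exact ⟨_, _, hmap t⟩
  have hpar := fun t => gaussianReal_ext_iff.1 ((map_inner_eq_gaussianReal (P := Q) t).symm.trans
    (hmap t))
  have hmean : ∫ x, x ∂Q = m := ext_inner_left ℝ fun t => (hpar t).1
  refine ⟨hG, hP, by rwa [hmean], fun t => ?_⟩
  have := (Real.toNNReal_eq_toNNReal_iff (covarianceBilin_self_nonneg t) (hc0 t)).1 (hpar t).2
  rw [this]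
  exact hc t

end GaussianLimit

end MicroMacro

namespace MicroMacro

/-! ### The law of the solution -/

section SolutionLaw

lemma map_sum_gaussianReal {Ω ι : Type*} {mΩ : MeasurableSpace Ω} {μ : Measure Ω}
    [IsProbabilityMeasure μ] {X : ι → Ω → ℝ} (s : Finset ι) {v : ι → ℝ≥0} (hX : iIndepFun X μ)
    (hlaw : ∀ i, HasLaw (X i) (gaussianReal 0 (v i)) μ) :
    HasLaw (fun ω => ∑ i ∈ s, X i ω) (gaussianReal 0 (∑ i ∈ s, v i)) μ where
  aemeasurable := Finset.aemeasurable_fun_sum _ fun i _ => (hlaw i).aemeasurable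
  map_eq := by
    have : IsFiniteMeasure (μ.map fun ω => ∑ i ∈ s, X i ω) := inferInstance
    apply Measure.ext_of_charFun
    rw [iIndepFun.charFun_map_fun_finsetSum_eq_prod (fun i _ => (hlaw i).aemeasurable)
      (hX.restrict _)]
    ext t
    rw [Finset.prod_apply, charFun_gaussianReal]
    simp_rw [fun i => (hlaw i).map_eq, charFun_gaussianReal]
    rw [← Complex.exp_sum]
    congr 1
    push_cast
    simp [Finset.sum_mul, Finset.sum_div]

variable {d m : ℕ} (A : Matrix (Fin d) (Fin d) ℝ) (B : Matrix (Fin d) (Fin m) ℝ)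
  {P₀ : Measure (Vec d)}

/-- The law after `k` Euler–Maruyama steps. -/
noncomputable def emLaw (δ : ℝ) (P₀ : Measure (Vec d)) (k : ℕ) : Measure (Vec d) :=
  (eulerMaruyamaStep A B δ)^[k] P₀

lemma emLaw_succ (δ : ℝ) (P₀ : Measure (Vec d)) (k : ℕ) :
    emLaw A B δ P₀ (k + 1) = eulerMaruyamaStep A B δ (emLaw A B δ P₀ k) :=
  Function.iterate_succ_apply' _ _ _

instance isGaussian_emLaw [h : IsGaussian P₀] (δ : ℝ) (k : ℕ) :
    IsGaussian (emLaw A B δ P₀ k) := by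
  induction k with
  | zero => exact h
  | succ k ih => rw [emLaw_succ]; infer_instance

lemma integral_emLaw [IsGaussian P₀] (δ : ℝ) (k : ℕ) :
    ∫ x, x ∂(emLaw A B δ P₀ k) = eulerPath A δ (∫ x, x ∂P₀) (fun _ => 0) k := by
  induction k with
  | zero => rfl
  | succ k ih => rw [emLaw_succ, integral_eulerMaruyamaStep, ih, eulerPath]; simp

/-- The weight of the noise of step `k` in the direction `t` after `N` Euler–Maruyama steps. -/
noncomputable def noiseWeight (δ : ℝ) (N : ℕ) (t : Vec d) (k : ℕ) : Vec m :=
  (toCLM B).adjoint (((stepCLM A δ).adjoint ^ (N - 1 - k)) t)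

lemma noiseWeight_succ (δ : ℝ) {N k : ℕ} (hk : k < N) (t : Vec d) :
    noiseWeight A B δ (N + 1) t k = noiseWeight A B δ N ((stepCLM A δ).adjoint t) k := by
  rw [noiseWeight, noiseWeight, show N + 1 - 1 - k = N - 1 - k + 1 by omega, pow_succ]
  rfl

lemma noiseWeight_succ_self (δ : ℝ) (N : ℕ) (t : Vec d) :
    noiseWeight A B δ (N + 1) t N = (toCLM B).adjoint t := by
  simp [noiseWeight]

/-- The noise of step `k` is carried through the `N - 1 - k` later steps. The weights are those of
`inner_eulerPath`, which lets the law of the scheme driven by `W` be matched with `emLaw`. -/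
lemma covarianceBilin_emLaw [IsGaussian P₀] {δ : ℝ} (hδ : 0 ≤ δ) (N : ℕ) (t : Vec d) :
    covarianceBilin (emLaw A B δ P₀ N) t t =
      covarianceBilin P₀ (((stepCLM A δ).adjoint ^ N) t) (((stepCLM A δ).adjoint ^ N) t) +
        ∑ k ∈ Finset.range N, δ * ‖noiseWeight A B δ N t k‖ ^ 2 := by
  induction N generalizing t with
  | zero => simp [emLaw]
  | succ N ih =>
    rw [emLaw_succ, covarianceBilin_eulerMaruyamaStep A B δ hδ, ih, Finset.sum_range_succ,
      noiseWeight_succ_self, pow_succ]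
    have : ∑ k ∈ Finset.range N, δ * ‖noiseWeight A B δ (N + 1) t k‖ ^ 2 =
        ∑ k ∈ Finset.range N, δ * ‖noiseWeight A B δ N ((stepCLM A δ).adjoint t) k‖ ^ 2 :=
      Finset.sum_congr rfl fun k hk => by
        rw [noiseWeight_succ A B δ (Finset.mem_range.1 hk)]
    rw [this, add_assoc]
    rfl

lemma inner_eulerPath (δ : ℝ) (x₀ : Vec d) (w : ℕ → Vec m) (N : ℕ) (t : Vec d) :
    inner ℝ t (eulerPath A δ x₀ (fun k => toCLM B (w k)) N) =
      inner ℝ (((stepCLM A δ).adjoint ^ N) t) x₀ +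
        ∑ k ∈ Finset.range N, inner ℝ (noiseWeight A B δ N t k) (w (k + 1) - w k) := by
  induction N generalizing t with
  | zero => simp [eulerPath]
  | succ N ih =>
    rw [eulerPath, inner_add_right, ← ContinuousLinearMap.adjoint_inner_left, ih,
      Finset.sum_range_succ, noiseWeight_succ_self, pow_succ, ← map_sub,
      ContinuousLinearMap.adjoint_inner_left]
    have : ∑ k ∈ Finset.range N, inner ℝ (noiseWeight A B δ (N + 1) t k) (w (k + 1) - w k) =
        ∑ k ∈ Finset.range N,
          inner ℝ (noiseWeight A B δ N ((stepCLM A δ).adjoint t) k) (w (k + 1) - w k) :=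
      Finset.sum_congr rfl fun k hk => by
        rw [noiseWeight_succ A B δ (Finset.mem_range.1 hk)]
    rw [this, add_assoc]
    rfl

variable {Ω : Type*} [MeasurableSpace Ω] {μ : Measure Ω} [IsProbabilityMeasure μ]
  {W : ℝ≥0 → Ω → Vec m}

/-- Weighted sums of the increments of a Wiener process are centred Gaussian variables. -/
lemma IsWienerProcess.hasLaw_sum_inner (hW : IsWienerProcess μ W) {δ : ℝ} (hδ : 0 ≤ δ)
    (w : ℕ → Vec m) (N : ℕ) :
    HasLaw (fun ω => ∑ k ∈ Finset.range N,
        inner ℝ (w k) (W ((k + 1 : ℕ) * δ).toNNReal ω - W (k * δ).toNNReal ω))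
      (gaussianReal 0 (∑ k ∈ Finset.range N, δ * ‖w k‖ ^ 2).toNNReal) μ := by
  have hmono : Monotone fun k : ℕ => (k * δ).toNNReal := fun i j hij => by
    refine Real.toNNReal_le_toNNReal ?_
    gcongr
  -- Independence in time is used within each coordinate, and independence of the coordinates
  -- afterwards.
  have hcoord : ∀ j : Fin m, HasLaw (fun ω => ∑ k ∈ Finset.range N,
      w k j * (W ((k + 1 : ℕ) * δ).toNNReal ω j - W (k * δ).toNNReal ω j))
      (gaussianReal 0 (∑ k ∈ Finset.range N, (δ * w k j ^ 2).toNNReal)) μ := by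
    intro j
    have hB := (hW.brownian j).toIsPreBrownianReal
    have hind := (hB.hasIndepIncrements.nat hmono).comp (fun k x => w k j * x) (by fun_prop)
    refine map_sum_gaussianReal (X := fun (k : ℕ) ω =>
      w k j * (W ((k + 1 : ℕ) * δ).toNNReal ω j - W (k * δ).toNNReal ω j)) _ hind fun k => ?_
    have h1 := gaussianReal_const_mul (hB.hasLaw_sub ((k + 1 : ℕ) * δ).toNNReal (k * δ).toNNReal)
      (w k j)
    convert! h1 using 2
    · simp
    · ext
      have hk : (0 : ℝ) ≤ k * δ := by positivity
      have hk1 : (0 : ℝ) ≤ (k + 1 : ℕ) * δ := by positivity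
      rw [Real.coe_toNNReal _ (by positivity)]
      simp only [NNReal.coe_mul, NNReal.coe_mk, coe_nndist]
      rw [NNReal.val_eq_coe, NNReal.val_eq_coe, Real.coe_toNNReal _ hk, Real.coe_toNNReal _ hk1,
        Real.dist_eq]
      push_cast
      rw [show ((k : ℝ) + 1) * δ - k * δ = δ by ring, abs_of_nonneg hδ]
      ring
  have hind : iIndepFun (fun (j : Fin m) ω => ∑ k ∈ Finset.range N,
      w k j * (W ((k + 1 : ℕ) * δ).toNNReal ω j - W (k * δ).toNNReal ω j)) μ :=
    hW.indep.comp (fun j (f : ℝ≥0 → ℝ) => ∑ k ∈ Finset.range N,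
      w k j * (f ((k + 1 : ℕ) * δ).toNNReal - f (k * δ).toNNReal)) fun j => by fun_prop
  have h := map_sum_gaussianReal Finset.univ hind hcoord
  convert! h using 2
  · rw [Finset.sum_comm]
    refine Finset.sum_congr rfl fun k _ => ?_
    simp only [PiLp.inner_apply, PiLp.sub_apply]
    refine Finset.sum_congr rfl fun j _ => ?_
    simp [mul_comm]
  · ext
    rw [Real.coe_toNNReal _ (Finset.sum_nonneg fun _ _ => by positivity)]
    push_cast
    rw [Finset.sum_comm]
    refine Finset.sum_congr rfl fun k _ => ?_
    rw [EuclideanSpace.norm_sq_eq, Finset.mul_sum]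
    refine Finset.sum_congr rfl fun j _ => ?_
    rw [Real.coe_toNNReal _ (by positivity), Real.norm_eq_abs, sq_abs]

variable {A B} {X : ℝ≥0 → Ω → Vec d}

/-- Along a solution the Euler scheme driven by `W` has the Euler–Maruyama law. -/
lemma IsLinearSDESolution.map_inner_eulerPath [IsGaussian P₀]
    (hX : IsLinearSDESolution μ A B P₀ W X) {δ : ℝ} (hδ : 0 ≤ δ) (N : ℕ) (t : Vec d) :
    HasLaw (fun ω => inner ℝ t
        (eulerPath A δ (X 0 ω) (fun k => toCLM B (W (k * δ).toNNReal ω)) N))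
      ((emLaw A B δ P₀ N).map (fun x => inner ℝ t x)) μ := by
  set L := ((stepCLM A δ).adjoint ^ N) t
  set Z : Ω → ℝ := fun ω => ∑ k ∈ Finset.range N, inner ℝ (noiseWeight A B δ N t k)
    (W ((k + 1 : ℕ) * δ).toNNReal ω - W (k * δ).toNNReal ω) with hZ
  have hZlaw : HasLaw Z _ μ := hX.wiener.hasLaw_sum_inner hδ (noiseWeight A B δ N t) N
  have hX0 : μ.map (fun ω => inner ℝ L (X 0 ω)) =
      gaussianReal (inner ℝ L (∫ x, x ∂P₀)) (covarianceBilin P₀ L L).toNNReal := by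
    rw [← map_inner_eq_gaussianReal, ← hX.initial_law, AEMeasurable.map_map_of_aemeasurable
      (by fun_prop) (hX.measurable 0)]
    rfl
  have hind : IndepFun (fun ω => inner ℝ L (X 0 ω)) Z μ :=
    hX.indep.comp (φ := fun x => inner ℝ L x)
      (ψ := fun f : ℝ≥0 → Vec m => ∑ k ∈ Finset.range N, inner ℝ (noiseWeight A B δ N t k)
        (f ((k + 1 : ℕ) * δ).toNNReal - f (k * δ).toNNReal)) (by fun_prop) (by fun_prop)
  have h := gaussianReal_add_gaussianReal_of_indepFun hind hX0 hZlaw.map_eq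
  have hfun : (fun ω => inner ℝ t
        (eulerPath A δ (X 0 ω) (fun k => toCLM B (W (k * δ).toNNReal ω)) N)) =
      (fun ω => inner ℝ L (X 0 ω)) + Z := by
    ext ω
    exact inner_eulerPath A B δ (X 0 ω) (fun k => W (k * δ).toNNReal ω) N t
  have hmeas : AEMeasurable (fun ω => inner ℝ L (X 0 ω)) μ :=
    AEMeasurable.inner aemeasurable_const (hX.measurable 0)
  have hmean : inner ℝ t (∫ x, x ∂(emLaw A B δ P₀ N)) = inner ℝ L (∫ x, x ∂P₀) := by
    rw [integral_emLaw]
    have h := inner_eulerPath A B δ (∫ x, x ∂P₀) (fun _ => 0) N t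
    simpa only [map_zero, sub_self, inner_zero_right, Finset.sum_const_zero, add_zero] using h
  refine ⟨hfun ▸ hmeas.add hZlaw.aemeasurable, ?_⟩
  rw [hfun, h, map_inner_eq_gaussianReal, hmean, add_zero, covarianceBilin_emLaw A B hδ,
    Real.toNNReal_add (covarianceBilin_self_nonneg _)
      (Finset.sum_nonneg fun _ _ => by positivity)]

lemma IsLinearSDESolution.tendsto_eulerPath (hX : IsLinearSDESolution μ A B P₀ W X) {T : ℝ≥0}
    (hT : 0 < T) : ∀ᵐ ω ∂μ, Tendsto (fun δ : ℝ =>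
      eulerPath A δ (X 0 ω) (fun k => toCLM B (W (k * δ).toNNReal ω)) (numSteps T δ))
      (𝓝[>] 0) (𝓝 (X T ω)) := by
  filter_upwards [hX.continuous_paths, hX.equation] with ω hc he
  have hu : Continuous fun t : ℝ => X t.toNNReal ω := hc.comp continuous_real_toNNReal
  have h := MicroMacro.tendsto_eulerPath (A := A) (u := fun t : ℝ => X t.toNNReal ω)
    (G := fun t : ℝ => toCLM B (W t.toNNReal ω)) (T := T) (NNReal.coe_pos.2 hT) hu ?_
  · simpa using h
  · intro s t hs hst
    have hAu : Continuous fun r : ℝ => toCLM A (X r.toNNReal ω) := (toCLM A).continuous.comp hu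
    rw [he t.toNNReal, he s.toNNReal, Real.coe_toNNReal _ hs, Real.coe_toNNReal _ (hs.trans hst),
      ← intervalIntegral.integral_interval_sub_left (hAu.intervalIntegrable 0 t)
        (hAu.intervalIntegrable 0 s)]
    simp only [toCLM_apply]
    abel

/-- The law of the solution at a positive time is Gaussian, and it is the limit of the laws of
the Euler–Maruyama scheme. -/
theorem IsLinearSDESolution.momentsTendsto [IsGaussian P₀]
    (hX : IsLinearSDESolution μ A B P₀ W X) {T : ℝ≥0} (hT : 0 < T) :
    IsGaussian (μ.map (X T)) ∧
      MomentsTendsto (fun δ => emLaw A B δ P₀ (numSteps T δ)) (𝓝[>] 0) (μ.map (X T)) := by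
  have : IsProbabilityMeasure (μ.map (X T)) := Measure.isProbabilityMeasure_map (hX.measurable T)
  obtain ⟨x, hx⟩ := exists_tendsto_eulerPath_zero A (NNReal.coe_pos.2 hT) (∫ x, x ∂P₀)
  refine momentsTendsto_of_charFun (Eventually.of_forall fun δ => inferInstance)
    (by simpa only [integral_emLaw] using hx) fun t => ?_
  have hcexp : Continuous fun y : ℝ => Complex.exp (y * Complex.I) := by fun_prop
  have hchar : ∀ P : Measure (Vec d), charFun P t = ∫ x, Complex.exp ((inner ℝ t x : ℝ) *
      Complex.I) ∂P := fun P => by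
    rw [charFun_apply]
    simp_rw [real_inner_comm t]
  -- Almost sure convergence of the scheme passes to characteristic functions, since the integrands
  -- have modulus one.
  have hlim : Tendsto (fun δ : ℝ => ∫ ω, Complex.exp ((inner ℝ t (eulerPath A δ (X 0 ω)
      (fun k => toCLM B (W (k * δ).toNNReal ω)) (numSteps T δ)) : ℝ) * Complex.I) ∂μ) (𝓝[>] 0)
      (𝓝 (∫ ω, Complex.exp ((inner ℝ t (X T ω) : ℝ) * Complex.I) ∂μ)) := by
    refine tendsto_integral_filter_of_dominated_convergence (fun _ => 1) ?_ ?_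
      (integrable_const _) ?_
    · filter_upwards [self_mem_nhdsWithin] with δ hδ
      exact (hcexp.measurable.comp_aemeasurable
        (hX.map_inner_eulerPath (le_of_lt hδ) _ t).aemeasurable).aestronglyMeasurable
    · exact Eventually.of_forall fun δ => ae_of_all _ fun ω => by
        rw [Complex.norm_exp_ofReal_mul_I]
    · filter_upwards [hX.tendsto_eulerPath hT] with ω hω
      exact (hcexp.tendsto _).comp (tendsto_const_nhds.inner hω)
  rw [hchar, integral_map (hX.measurable T) (by fun_prop)]
  refine hlim.congr' ?_
  filter_upwards [self_mem_nhdsWithin] with δ hδ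
  have hlaw := hX.map_inner_eulerPath (le_of_lt hδ) (numSteps T δ) t
  have h1 := integral_map hlaw.aemeasurable (f := fun y : ℝ => Complex.exp (y * Complex.I))
    hcexp.aestronglyMeasurable
  rw [hlaw.map_eq, integral_map (by fun_prop) hcexp.aestronglyMeasurable] at h1
  rw [hchar, h1]

end SolutionLaw

end MicroMacro

namespace MicroMacro

open InformationTheory

/-! ### Convergence of micro-macro runs -/

section RunLimit

variable {d m ds : ℕ}

/-- A null vector of a semidefinite form is in its radical: otherwise moving from `v` along `-covOp
P v` would make the variance negative. -/
lemma covOp_eq_zero {P : Measure (Vec d)} {v : Vec d} (hv : covarianceBilin P v v = 0) :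
    covOp P v = 0 := by
  by_contra hne
  set t := covOp P v with ht
  have hq : 0 < ‖t‖ ^ 2 := by positivity
  have hvt : covarianceBilin P v t = ‖t‖ ^ 2 := by
    rw [← inner_covOp, ← ht, real_inner_self_eq_norm_sq]
  have hc := covarianceBilin_self_nonneg (μ := P) t
  set c := covarianceBilin P t t with hcdef
  -- This is nearly the minimizer of `2 s ‖t‖² + s² c`; the `+ 1` covers `c = 0`.
  set s := -(‖t‖ ^ 2 / (c + 1)) with hs
  have h := covarianceBilin_self_nonneg (μ := P) (v + s • t)
  have hexp : covarianceBilin P (v + s • t) (v + s • t) = 2 * s * ‖t‖ ^ 2 + s ^ 2 * c := by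
    simp only [map_add, map_smul, _root_.add_apply, _root_.smul_apply, smul_eq_mul,
      covarianceBilin_comm t v, hv, hvt, ← hcdef]
    ring
  have hs1 : s * (c + 1) = -‖t‖ ^ 2 := by
    rw [hs]
    field_simp
  rw [hexp] at h
  have hsneg : s < 0 := by
    rw [hs, neg_lt_zero]
    positivity
  nlinarith [sq_nonneg s, mul_pos_of_neg_of_neg hsneg hsneg]

/-- The translation in a matching is a linear function of the change of the slow mean. -/
lemma exists_covOp_eq_comp_slowCov (S : Matrix (Fin ds) (Fin d) ℝ) (P : Measure (Vec d)) :
    ∃ H : Vec ds →L[ℝ] Vec d, ∀ l,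
      covOp P ((toCLM S).adjoint l) = H (slowCov S P l) := by
  set f := (slowCov S P).toLinearMap with hf
  obtain ⟨g, hg⟩ := f.rangeRestrict.exists_rightInverse_of_surjective f.range_rangeRestrict
  obtain ⟨g', hg'⟩ := g.exists_extend
  have hfg : ∀ l, f (g' (f l)) = f l := fun l => by
    have h1 : g' (f l) = g (f.rangeRestrict l) := LinearMap.congr_fun hg' (f.rangeRestrict l)
    have h2 := LinearMap.congr_fun hg (f.rangeRestrict l)
    rw [h1]
    exact congrArg Subtype.val h2
  refine ⟨covOp P ∘L (toCLM S).adjoint ∘L g'.toContinuousLinearMap, fun l => ?_⟩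
  -- `g'` inverts `slowCov S P` on its range, so `l - g' (f l)` lies in the kernel and its image
  -- under `Sᵀ` has zero variance.
  have h0 : covOp P ((toCLM S).adjoint (l - g' (f l))) = 0 := by
    apply covOp_eq_zero
    have h1 : slowCov S P (l - g' (f l)) = 0 := by
      have : f (l - g' (f l)) = 0 := by rw [map_sub, hfg, sub_self]
      exact this
    rw [← inner_slowCov, h1, inner_zero_left]
  rw [map_sub, map_sub, sub_eq_zero] at h0
  exact h0

variable (A : Matrix (Fin d) (Fin d) ℝ) (B : Matrix (Fin d) (Fin m) ℝ)
  {S : Matrix (Fin ds) (Fin d) ℝ} {P₀ : Measure (Vec d)} {δ Δ : ℝ}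

lemma covarianceBilin_eulerMaruyamaStep_congr {P Q : Measure (Vec d)} [IsGaussian P]
    [IsGaussian Q] (hδ : 0 ≤ δ) (h : covarianceBilin P = covarianceBilin Q) :
    covarianceBilin (eulerMaruyamaStep A B δ P) = covarianceBilin (eulerMaruyamaStep A B δ Q) :=
  covarianceBilin_eq_of_self fun t => by
    rw [covarianceBilin_eulerMaruyamaStep A B δ hδ, covarianceBilin_eulerMaruyamaStep A B δ hδ, h]

variable {A B}

/-- The laws of a run are Gaussian, with the covariances of the Euler–Maruyama scheme. -/
lemma IsMicroMacroRun.isGaussian_and_cov [hG : IsGaussian P₀] {P : ℕ → Measure (Vec d)}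
    (hP : IsMicroMacroRun A B S P₀ δ Δ P) (hδ : 0 ≤ δ) (n : ℕ) :
    IsGaussian (P n) ∧ covarianceBilin (P n) = covarianceBilin (emLaw A B δ P₀ n) := by
  induction n with
  | zero => rw [hP.init]; exact ⟨hG, rfl⟩
  | succ n ih =>
    have := ih.1
    have h := hP.step n
    refine ⟨h.isGaussian, ?_⟩
    rw [h.covarianceBilin_eq, emLaw_succ]
    exact covarianceBilin_eulerMaruyamaStep_congr A B hδ ih.2

lemma covOp_congr {P Q : Measure (Vec d)} (h : covarianceBilin P = covarianceBilin Q) :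
    covOp P = covOp Q := by
  rw [covOp, covOp, h]

lemma slowCov_congr {P Q : Measure (Vec d)} (h : covarianceBilin P = covarianceBilin Q) :
    slowCov S P = slowCov S Q := by
  rw [slowCov, slowCov, covOp_congr h]

/-- This is the gap that matching must close; its factor `Δ / δ - 1` vanishes as `Δ` decreases to
`δ`. -/
lemma extrapolatedMean_sub {P Q : Measure (Vec d)} [IsGaussian P] [IsGaussian Q] :
    extrapolatedMean S δ Δ P Q - toCLM S (∫ x, x ∂Q) =
      (Δ / δ - 1) • (toCLM S (∫ x, x ∂Q) - toCLM S (∫ x, x ∂P)) := by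
  rw [extrapolatedMean, slowMean_eq, slowMean_eq, sub_smul, one_smul]
  abel

/-- As the extrapolation step decreases to the inner step, the moments of the laws of the runs
converge to those of the Euler–Maruyama scheme. -/
lemma momentsTendsto_run [IsGaussian P₀] (hδ : 0 < δ) {P : ℝ → ℕ → Measure (Vec d)}
    (hP : ∀ᶠ Δ in 𝓝[>] δ, IsMicroMacroRun A B S P₀ δ Δ (P Δ)) (n : ℕ) :
    MomentsTendsto (fun Δ => P Δ n) (𝓝[>] δ) (emLaw A B δ P₀ n) where
  isGaussian := hP.mono fun Δ h => (h.isGaussian_and_cov hδ.le n).1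
  cov t := tendsto_const_nhds.congr' <| hP.mono fun Δ h => by
    beta_reduce
    rw [(h.isGaussian_and_cov hδ.le n).2]
  mean := by
    induction n with
    | zero =>
      exact tendsto_const_nhds.congr' <| hP.mono fun Δ h => by
        beta_reduce
        rw [h.init]
        rfl
    | succ n ih =>
      -- The covariances of the runs do not depend on `Δ`, so one operator `H` gives the translation
      -- for every `Δ`.
      obtain ⟨H, hH⟩ := exists_covOp_eq_comp_slowCov S
        (eulerMaruyamaStep A B δ (emLaw A B δ P₀ n))
      have hcoef : Tendsto (fun Δ : ℝ => Δ / δ - 1) (𝓝[>] δ) (𝓝 0) := by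
        have h1 : Tendsto (fun Δ : ℝ => Δ / δ - 1) (𝓝 δ) (𝓝 (δ / δ - 1)) :=
          ((continuous_id.div_const δ).sub continuous_const).tendsto δ
        rw [div_self hδ.ne', sub_self] at h1
        exact h1.mono_left nhdsWithin_le_nhds
      have hL := ((stepCLM A δ).continuous.tendsto _).comp ih
      have hlim := hL.add ((H.continuous.tendsto _).comp (hcoef.smul
        ((((toCLM S).continuous.tendsto _).comp hL).sub
          (((toCLM S).continuous.tendsto _).comp ih))))
      rw [zero_smul, map_zero, add_zero, ← integral_eulerMaruyamaStep A B, ← emLaw_succ] at hlim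
      refine hlim.congr' ?_
      filter_upwards [hP] with Δ hΔ
      obtain ⟨hG, hcov⟩ := hΔ.isGaussian_and_cov hδ.le n
      have hcov' := covarianceBilin_eulerMaruyamaStep_congr A B hδ.le hcov
      obtain ⟨l, hl, hQ⟩ := (hΔ.step n).exists_translate
      rw [hQ, integral_id_map_add_const, covOp_congr hcov', hH, ← slowCov_congr hcov', hl,
        extrapolatedMean_sub, integral_eulerMaruyamaStep]
      rfl

/-- The inner limits are the divergence and distance of the Euler–Maruyama law from `Q`. That law is
nondegenerate for small `δ` because nondegeneracy is open. -/
theorem iteratedLimit_of_moments [IsGaussian P₀] {Q : Measure (Vec d)} [IsGaussian Q]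
    (hQ : ∀ v, v ≠ 0 → 0 < covarianceBilin Q v v) {T : ℝ} (hT : 0 < T)
    (hEM : MomentsTendsto (fun δ => emLaw A B δ P₀ (numSteps T δ)) (𝓝[>] 0) Q)
    {P : ℝ → ℝ → ℕ → Measure (Vec d)}
    (hP : ∀ᶠ δ in 𝓝[>] (0 : ℝ), ∀ᶠ Δ in 𝓝[>] δ, IsMicroMacroRun A B S P₀ δ Δ (P δ Δ)) :
    IteratedLimit (fun δ Δ => klDiv (P δ Δ ⌊T / Δ⌋₊) Q) 0 ∧
      IteratedLimit (fun δ Δ => tvDist (P δ Δ ⌊T / Δ⌋₊) Q) 0 := by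
  have hKL := hEM.tendsto_klDiv hQ hQ
  rw [klDiv_self] at hKL
  refine ⟨⟨fun δ => klDiv (emLaw A B δ P₀ (numSteps T δ)) Q, ?_, hKL⟩,
    ⟨fun δ => tvDist (emLaw A B δ P₀ (numSteps T δ)) Q, ?_,
      tendsto_tvDist_of_klDiv (Eventually.of_forall fun δ => inferInstance) hKL⟩⟩
  · filter_upwards [hP, hEM.eventually_nondegenerate hQ, self_mem_nhdsWithin] with δ hrun hnd hδ
    refine ((momentsTendsto_run hδ hrun (numSteps T δ)).tendsto_klDiv hnd hQ).congr' ?_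
    filter_upwards [eventually_floor_eq_numSteps hT hδ] with Δ hΔ
    rw [hΔ]
  · filter_upwards [hP, hEM.eventually_nondegenerate hQ, self_mem_nhdsWithin] with δ hrun hnd hδ
    have hm := momentsTendsto_run hδ hrun (numSteps T δ)
    -- Here the reference law is the Euler–Maruyama law itself. Its distance from the run tends to
    -- zero, and the reverse triangle inequality transfers this to the distances from `Q`.
    have h0 := hm.tendsto_klDiv hnd hnd
    rw [klDiv_self] at h0
    have hG : ∀ᶠ Δ in 𝓝[>] δ, IsProbabilityMeasure (P δ Δ (numSteps T δ)) :=
      hm.isGaussian.mono fun Δ h => inferInstance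
    have htv := tendsto_tvDist_of_klDiv hG h0
    rw [tendsto_iff_dist_tendsto_zero]
    refine squeeze_zero' (Eventually.of_forall fun _ => dist_nonneg) ?_ htv
    filter_upwards [eventually_floor_eq_numSteps hT hδ, hG] with Δ hΔ hprob
    rw [hΔ, Real.dist_eq]
    exact abs_tvDist_sub_tvDist_le

end RunLimit

end MicroMacro
theorem mainTheorem1 {d m ds : ℕ}
    (A : Matrix (Fin d) (Fin d) ℝ) (B : Matrix (Fin d) (Fin m) ℝ)
    (S : Matrix (Fin ds) (Fin d) ℝ) (hS : S * Sᵀ = 1)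
    (P₀ : Measure (MicroMacro.Vec d)) (hP₀ : IsGaussian P₀) :
    ((MicroMacro.IsNondegenerate P₀ ∨ (B * Bᵀ).PosDef) →
      ∀ᶠ δ in 𝓝[>] (0 : ℝ), ∀ Δ : ℝ, δ ≤ Δ →
        ∃! P : ℕ → Measure (MicroMacro.Vec d), MicroMacro.IsMicroMacroRun A B S P₀ δ Δ P) ∧
    (∀ {Ω : Type*} [MeasurableSpace Ω] (μ : Measure Ω) [IsProbabilityMeasure μ]
      (W : ℝ≥0 → Ω → MicroMacro.Vec m) (X : ℝ≥0 → Ω → MicroMacro.Vec d)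
      (_ : MicroMacro.IsLinearSDESolution μ A B P₀ W X)
      (T : ℝ≥0) (_ : 0 < T) (_ : MicroMacro.IsNondegenerate (μ.map (X T)))
      (P : ℝ → ℝ → ℕ → Measure (MicroMacro.Vec d))
      (_ : ∀ᶠ δ in 𝓝[>] (0 : ℝ), ∀ᶠ Δ in 𝓝[>] δ,
        MicroMacro.IsMicroMacroRun A B S P₀ δ Δ (P δ Δ)),
      MicroMacro.IteratedLimit
        (fun δ Δ => InformationTheory.klDiv (P δ Δ ⌊(T : ℝ) / Δ⌋₊) (μ.map (X T))) 0 ∧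
      MicroMacro.IteratedLimit
        (fun δ Δ => MicroMacro.tvDist (P δ Δ ⌊(T : ℝ) / Δ⌋₊) (μ.map (X T))) 0) := by
  refine ⟨fun h => ?_, fun μ _ W X hX T hT hnd P hP => ?_⟩
  · filter_upwards [MicroMacro.existsUnique_isMicroMacroRun A B S hS h] with δ hδ Δ _
    exact hδ Δ
  · obtain ⟨hG, hEM⟩ := hX.momentsTendsto hT
    exact MicroMacro.iteratedLimit_of_moments (MicroMacro.isNondegenerate_iff.1 hnd)
      (NNReal.coe_pos.2 hT) hEM hP
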